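/- **Setting.** Let $(\Omega,\mathfrak F,\mathbb P)$ be a probability space, $n,m,N\in\mathbb N$ and $0\le l\le N-1$. Let $\xi$ be a square integrable $\mathbb R^n$-valued random variable and $\omega_l,\dots,\omega_{N-1}$ real square integrable random variables. For $l\le k\le N-1$ let $\mathcal G_k=\sigma(\xi,\omega_l,\dots,\omega_{k-1})$ (so $\mathcal G_l=\sigma(\xi)$), and assume $\mathbb E[\omega_k\mid\mathcal G_k]=0$, $\mathbb E[\omega_k^2\mid\mathcal G_k]=1$. Let $\mathscr U_{ad}$ be the set of $u=(u_l,\dots,u_{N-1})$ with $u_k$ an $\mathbb R^m$-valued, $\mathcal G_k$-measurable, square integrable random variable. For $u\in\mathscr U_{ad}$ the state is given by $x_l=\xi$ and $$x_{k+1}=A_kx_k+\bar A_k\mathbb Ex_k+B_ku_k+\bar B_k\mathbb Eu_k+b_k+\big(C_kx_k+\bar C_k\mathbb Ex_k+D_ku_k+\bar D_k\mathbb Eu_k+\sigma_k\big)\omega_k ,$$ and the cost is $$\begin{aligned}J(l,\xi;u)=\mathbb E\Big\{&\langle Gx_N,x_N\rangle+2\langle g,x_N\rangle+\langle\bar G\mathbb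 Ex_N,\mathbb Ex_N\rangle+2\langle\bar g,\mathbb Ex_N\rangle\\&+\sum_{k=l}^{N-1}\big[\langle Q_kx_k,x_k\rangle+2\langle S_kx_k,u_k\rangle+\langle R_ku_k,u_k\rangle+2\langle q_k,x_k\rangle+2\langle\rho_k,u_k\rangle\big]\\&+\sum_{k=l}^{N-1}\big[\langle\bar Q_k\mathbb Ex_k,\mathbb Ex_k\rangle+2\langle\bar S_k\mathbb Ex_k,\mathbb Eu_k\rangle+\langle\bar R_k\mathbb Eu_k,\mathbb Eu_k\rangle+2\langle\bar q_k,\mathbb Ex_k\rangle+2\langle\bar\rho_k,\mathbb Eu_k\rangle\big]\Big\}.\end{aligned}$$ All matrices and $b_k,\sigma_k$ are deterministic; $Q_k,\bar Q_k,R_k,\bar R_k,G,\bar G$ are symmetric (of arbitrary sign); $g,\bar g,q_k,\bar q_k,\rho_k,\bar\rho_k$ are square integrable random vectors. Let $V(l,\xi)=\inf_{u\in\mathscr U_{ad}}J(l,\xi;u)\in[-\infty,\infty)$; the problem is *finite* at $(l,\xi)$ if $V(l,\xi)>-\infty$. For $\varepsilon>0$ let $J^\varepsilon(l,\xi;u)=J(l,\xi;u)+\varepsilon\,\mathbb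 E\sum_{k=l}^{N-1}|u_k|^2$ and $V^\varepsilon(l,\xi)=\inf_{u\in\mathscr U_{ad}}J^\varepsilon(l,\xi;u)$. Let $J^0$ denote the cost $J$ when $b,\sigma,g,\bar g,q,\bar q,\rho,\bar\rho$ are all replaced by $0$. For $\varepsilon>0$ put $P^\varepsilon_N=G$, $\Pi^\varepsilon_N=G+\bar G$, $\eta^\varepsilon_N=\mathbb E(g+\bar g)$ and, for $k<N$, $$\begin{aligned} \Upsilon^\varepsilon_k&=R_k+\varepsilon I+B_k'P^\varepsilon_{k+1}B_k+D_k'P^\varepsilon_{k+1}D_k,\qquad H^\varepsilon_k=B_k'P^\varepsilon_{k+1}A_k+D_k'P^\varepsilon_{k+1}C_k+S_k,\\ \bar\Upsilon^\varepsilon_k&=R_k+\bar R_k+\varepsilon I+(B_k+\bar B_k)'\Pi^\varepsilon_{k+1}(B_k+\bar B_k)+(D_k+\bar D_k)'P^\varepsilon_{k+1}(D_k+\bar D_k),\\ \bar H^\varepsilon_k&=(B_k+\bar B_k)'\Pi^\varepsilon_{k+1}(A_k+\bar A_k)+(D_k+\bar D_k)'P^\varepsilon_{k+1}(C_k+\bar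 C_k)+S_k+\bar S_k,\\ P^\varepsilon_k&=Q_k+A_k'P^\varepsilon_{k+1}A_k+C_k'P^\varepsilon_{k+1}C_k-(H^\varepsilon_k)'(\Upsilon^\varepsilon_k)^{-1}H^\varepsilon_k,\\ \Pi^\varepsilon_k&=Q_k+\bar Q_k+(A_k+\bar A_k)'\Pi^\varepsilon_{k+1}(A_k+\bar A_k)+(C_k+\bar C_k)'P^\varepsilon_{k+1}(C_k+\bar C_k)-(\bar H^\varepsilon_k)'(\bar\Upsilon^\varepsilon_k)^{-1}\bar H^\varepsilon_k,\\ \Theta^\varepsilon_k&=-(\Upsilon^\varepsilon_k)^{-1}H^\varepsilon_k,\qquad \bar\Theta^\varepsilon_k=-(\bar\Upsilon^\varepsilon_k)^{-1}\bar H^\varepsilon_k,\\ \zeta^\varepsilon_k&=(D_k+\bar D_k)'P^\varepsilon_{k+1}\sigma_k+(B_k+\bar B_k)'(\Pi^\varepsilon_{k+1}b_k+\eta^\varepsilon_{k+1})+\mathbb E(\rho_k+\bar\rho_k),\qquad v^\varepsilon_k=-(\bar\Upsilon^\varepsilon_k)^{-1}\zeta^\varepsilon_k,\\ \eta^\varepsilon_k&=(C_k+\bar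 C_k)'P^\varepsilon_{k+1}\sigma_k+(A_k+\bar A_k)'(\Pi^\varepsilon_{k+1}b_k+\eta^\varepsilon_{k+1})+\mathbb E(q_k+\bar q_k)+(\bar\Theta^\varepsilon_k)'\zeta^\varepsilon_k \end{aligned}$$ (with the convention that the inverse of a singular matrix is $0$). Let $u^\varepsilon$ be the feedback control $$u^\varepsilon_k=\Theta^\varepsilon_k(x^\varepsilon_k-\mathbb Ex^\varepsilon_k)+\bar\Theta^\varepsilon_k\mathbb Ex^\varepsilon_k+v^\varepsilon_k,\qquad l\le k\le N-1,$$ where $x^\varepsilon$ is the state generated by this feedback, $x^\varepsilon_l=\xi$. **Theorem 6.2.** Assume (A1): $J^0(l,0;u)\ge0$ for all $u\in\mathscr U_{ad}$. Then: (i) $\lim_{\varepsilon\downarrow0}V^\varepsilon(l,\xi)=V(l,\xi)$ in $[-\infty,\infty]$. In particular, the problem is finite at $(l,\xi)$ if and only if $\{V^\varepsilon(l,\xi)\}_{\varepsilon>0}$ is bounded from below. (ii) For every $\varepsilon>0$ and $l\le k\le N-1$ one has $\bar\Upsilon^\varepsilon_k\ge\varepsilon I$, and $\Upsilon^\varepsilon_k\ge\varepsilon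 I$ except possibly if $k=l$ and $\xi$ is a.s. constant. If $g$, $q_k$, $\rho_k$ are a.s. constant (for all $k$), then $u^\varepsilon\in\mathscr U_{ad}$ is an optimal control for $J^\varepsilon(l,\xi;\cdot)$ for every $\varepsilon>0$, and $\{u^\varepsilon\}_{\varepsilon>0}$ is a minimizing sequence of $u\mapsto J(l,\xi;u)$: $\lim_{\varepsilon\downarrow0}J(l,\xi;u^\varepsilon)=V(l,\xi)$. For arbitrary square integrable random $g,q_k,\rho_k$, every family consisting of an optimal control $u^\varepsilon$ for $J^\varepsilon(l,\xi;\cdot)$ for each $\varepsilon>0$ is minimizing in the same sense. -/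

import Mathlib

open MeasureTheory Filter Topology
open scoped Matrix

namespace MFLQ

/-- The solution on `{0, …, N}` of the backward recursion `a N = term`,
`a k = step k (a (k + 1))` for `k < N`. -/
def backward {α : Type*} (N : ℕ) (term : α) (step : ℕ → α → α) (k : ℕ) : α :=
  Nat.rec term (fun j a => step (N - 1 - j) a) (N - k)

theorem backward_terminal {α : Type*} (N : ℕ) (term : α) (step : ℕ → α → α) :
    backward N term step N = term := by
  simp [backward]

theorem backward_step {α : Type*} (N : ℕ) (term : α) (step : ℕ → α → α) {k : ℕ} (hk : k < N) :
    backward N term step k = step k (backward N term step (k + 1)) := by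
  obtain ⟨j, rfl⟩ : ∃ j, N = k + 1 + j := ⟨N - (k + 1), by omega⟩
  have h1 : k + 1 + j - k = j + 1 := by omega
  have h2 : k + 1 + j - (k + 1) = j := by omega
  have h3 : k + 1 + j - 1 - j = k := by omega
  simp only [backward, h1, h2, h3]

/-- The data of a discrete-time mean-field linear-quadratic problem with horizon `N`,
state space `ℝⁿ` and control space `ℝᵐ`. The matrices and the vectors `b`, `σ` are deterministic;
the linear weights `g`, `gbar`, `q`, `qbar`, `ρ`, `ρbar` of the cost are random. Only the values at
times `k < N` matter. The quadratic weights are symmetric but need not be definite. -/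
structure Problem (Ω : Type*) (n m : ℕ) where
  N : ℕ
  A : ℕ → Matrix (Fin n) (Fin n) ℝ
  Abar : ℕ → Matrix (Fin n) (Fin n) ℝ
  B : ℕ → Matrix (Fin n) (Fin m) ℝ
  Bbar : ℕ → Matrix (Fin n) (Fin m) ℝ
  C : ℕ → Matrix (Fin n) (Fin n) ℝ
  Cbar : ℕ → Matrix (Fin n) (Fin n) ℝ
  D : ℕ → Matrix (Fin n) (Fin m) ℝ
  Dbar : ℕ → Matrix (Fin n) (Fin m) ℝ
  b : ℕ → Fin n → ℝ
  σ : ℕ → Fin n → ℝ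
  Q : ℕ → Matrix (Fin n) (Fin n) ℝ
  Qbar : ℕ → Matrix (Fin n) (Fin n) ℝ
  S : ℕ → Matrix (Fin m) (Fin n) ℝ
  Sbar : ℕ → Matrix (Fin m) (Fin n) ℝ
  R : ℕ → Matrix (Fin m) (Fin m) ℝ
  Rbar : ℕ → Matrix (Fin m) (Fin m) ℝ
  G : Matrix (Fin n) (Fin n) ℝ
  Gbar : Matrix (Fin n) (Fin n) ℝ
  q : ℕ → Ω → Fin n → ℝ
  qbar : ℕ → Ω → Fin n → ℝ
  ρ : ℕ → Ω → Fin m → ℝ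
  ρbar : ℕ → Ω → Fin m → ℝ
  g : Ω → Fin n → ℝ
  gbar : Ω → Fin n → ℝ
  Q_symm : ∀ k, (Q k).IsSymm
  Qbar_symm : ∀ k, (Qbar k).IsSymm
  R_symm : ∀ k, (R k).IsSymm
  Rbar_symm : ∀ k, (Rbar k).IsSymm
  G_symm : G.IsSymm
  Gbar_symm : Gbar.IsSymm

/-- The information available when the control at time `k` is chosen: the σ-algebra generated by
the initial state `ξ` and the noises `w l, …, w (k - 1)`. -/
@[reducible] def past {Ω : Type*} {n : ℕ} (w : ℕ → Ω → ℝ) (l : ℕ) (ξ : Ω → Fin n → ℝ) (k : ℕ) :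
    MeasurableSpace Ω :=
  MeasurableSpace.comap ξ inferInstance ⊔
    ⨆ j ∈ Finset.Ico l k, MeasurableSpace.comap (w j) inferInstance

/-- `w l, …, w (N - 1)` is a martingale difference sequence with unit conditional variance. -/
def IsNoise {Ω : Type*} [MeasurableSpace Ω] (μ : Measure Ω) {n : ℕ} (w : ℕ → Ω → ℝ)
    (l N : ℕ) (ξ : Ω → Fin n → ℝ) : Prop :=
  ∀ k ∈ Finset.Ico l N, Measurable (w k) ∧ MemLp (w k) 2 μ ∧
    μ[w k | past w l ξ k] =ᵐ[μ] (fun _ => (0 : ℝ)) ∧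
    μ[fun ω => w k ω ^ 2 | past w l ξ k] =ᵐ[μ] (fun _ => (1 : ℝ))

/-- Admissible controls: square integrable and nonanticipative. -/
def Admissible {Ω : Type*} [MeasurableSpace Ω] (μ : Measure Ω) {n m : ℕ} (w : ℕ → Ω → ℝ)
    (l N : ℕ) (ξ : Ω → Fin n → ℝ) : Set (ℕ → Ω → Fin m → ℝ) :=
  {u | ∀ k ∈ Finset.Ico l N, Measurable[past w l ξ k] (u k) ∧ MemLp (u k) 2 μ}

namespace Problem

variable {Ω : Type*} {n m : ℕ}

/-- The problem with `b`, `σ` and all the linear weights of the cost replaced by zero. -/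
def homogeneous (M : Problem Ω n m) : Problem Ω n m :=
  { M with b := 0, σ := 0, q := 0, qbar := 0, ρ := 0, ρbar := 0, g := 0, gbar := 0 }

variable [MeasurableSpace Ω]

/-- The linear weights of the cost are square integrable. -/
def SquareIntegrable (M : Problem Ω n m) (μ : Measure Ω) : Prop :=
  MemLp M.g 2 μ ∧ MemLp M.gbar 2 μ ∧
    ∀ k < M.N, MemLp (M.q k) 2 μ ∧ MemLp (M.qbar k) 2 μ ∧ MemLp (M.ρ k) 2 μ ∧ MemLp (M.ρbar k) 2 μ

/-- The weights `g`, `q k`, `ρ k` are almost surely constant. (The weights `gbar`, `qbar k`, `ρbar k`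
are paired with expectations and enter the cost only through their means.) -/
def DeterministicWeights (M : Problem Ω n m) (μ : Measure Ω) : Prop :=
  (∃ c, M.g =ᵐ[μ] fun _ => c) ∧
    ∀ k < M.N, (∃ c, M.q k =ᵐ[μ] fun _ => c) ∧ (∃ c, M.ρ k =ᵐ[μ] fun _ => c)

/-- One step of the controlled mean-field difference equation. -/
noncomputable def step (M : Problem Ω n m) (μ : Measure Ω) (w : ℕ → Ω → ℝ) (k : ℕ)
    (x : Ω → Fin n → ℝ) (u : Ω → Fin m → ℝ) : Ω → Fin n → ℝ := fun ω =>
  M.A k *ᵥ x ω + M.Abar k *ᵥ (∫ ω', x ω' ∂μ) + M.B k *ᵥ u ω + M.Bbar k *ᵥ (∫ ω', u ω' ∂μ) + M.b k +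
    w k ω • (M.C k *ᵥ x ω + M.Cbar k *ᵥ (∫ ω', x ω' ∂μ) + M.D k *ᵥ u ω +
      M.Dbar k *ᵥ (∫ ω', u ω' ∂μ) + M.σ k)

/-- The state process started from `ξ` at time `l`, when the control at time `k` is
`policy k x`, with `x` the state at time `k`. (It equals `ξ` at the irrelevant times before `l`.) -/
noncomputable def trajectory (M : Problem Ω n m) (μ : Measure Ω) (w : ℕ → Ω → ℝ) (l : ℕ)
    (ξ : Ω → Fin n → ℝ) (policy : ℕ → (Ω → Fin n → ℝ) → (Ω → Fin m → ℝ)) :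
    ℕ → Ω → Fin n → ℝ
  | 0 => ξ
  | k + 1 =>
    if k < l then ξ
    else M.step μ w k (M.trajectory μ w l ξ policy k)
      (policy k (M.trajectory μ w l ξ policy k))

/-- The state process of the control `u`, started from `ξ` at time `l`. -/
noncomputable def state (M : Problem Ω n m) (μ : Measure Ω) (w : ℕ → Ω → ℝ) (l : ℕ)
    (ξ : Ω → Fin n → ℝ) (u : ℕ → Ω → Fin m → ℝ) : ℕ → Ω → Fin n → ℝ :=
  M.trajectory μ w l ξ (fun k _ => u k)

/-- The cost functional `J(l, ξ; u)`. -/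
noncomputable def cost (M : Problem Ω n m) (μ : Measure Ω) (w : ℕ → Ω → ℝ) (l : ℕ)
    (ξ : Ω → Fin n → ℝ) (u : ℕ → Ω → Fin m → ℝ) : ℝ :=
  let x := M.state μ w l ξ u
  let Ex : ℕ → Fin n → ℝ := fun k => ∫ ω, x k ω ∂μ
  let Eu : ℕ → Fin m → ℝ := fun k => ∫ ω, u k ω ∂μ
  ∫ ω, ((M.G *ᵥ x M.N ω) ⬝ᵥ x M.N ω + 2 * (M.g ω ⬝ᵥ x M.N ω)
      + (M.Gbar *ᵥ Ex M.N) ⬝ᵥ Ex M.N + 2 * (M.gbar ω ⬝ᵥ Ex M.N)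
      + ∑ k ∈ Finset.Ico l M.N,
        ((M.Q k *ᵥ x k ω) ⬝ᵥ x k ω + 2 * ((M.S k *ᵥ x k ω) ⬝ᵥ u k ω) + (M.R k *ᵥ u k ω) ⬝ᵥ u k ω
          + 2 * (M.q k ω ⬝ᵥ x k ω + M.ρ k ω ⬝ᵥ u k ω))
      + ∑ k ∈ Finset.Ico l M.N,
        ((M.Qbar k *ᵥ Ex k) ⬝ᵥ Ex k + 2 * ((M.Sbar k *ᵥ Ex k) ⬝ᵥ Eu k) + (M.Rbar k *ᵥ Eu k) ⬝ᵥ Eu k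
          + 2 * (M.qbar k ω ⬝ᵥ Ex k + M.ρbar k ω ⬝ᵥ Eu k))) ∂μ

/-- The regularized cost `J^ε(l, ξ; u) = J(l, ξ; u) + ε 𝔼 ∑ |u_k|²`. -/
noncomputable def costReg (M : Problem Ω n m) (μ : Measure Ω) (w : ℕ → Ω → ℝ) (l : ℕ)
    (ξ : Ω → Fin n → ℝ) (ε : ℝ) (u : ℕ → Ω → Fin m → ℝ) : ℝ :=
  M.cost μ w l ξ u + ε * ∫ ω, ∑ k ∈ Finset.Ico l M.N, u k ω ⬝ᵥ u k ω ∂μ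

/-- The value function `V(l, ξ)`, with values in `[-∞, ∞]`. -/
noncomputable def value (M : Problem Ω n m) (μ : Measure Ω) (w : ℕ → Ω → ℝ) (l : ℕ)
    (ξ : Ω → Fin n → ℝ) : EReal :=
  ⨅ u ∈ Admissible (m := m) μ w l M.N ξ, ((M.cost μ w l ξ u : ℝ) : EReal)

/-- The value function `V^ε(l, ξ)` of the regularized problem. -/
noncomputable def valueReg (M : Problem Ω n m) (μ : Measure Ω) (w : ℕ → Ω → ℝ) (l : ℕ)
    (ξ : Ω → Fin n → ℝ) (ε : ℝ) : EReal :=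
  ⨅ u ∈ Admissible (m := m) μ w l M.N ξ, ((M.costReg μ w l ξ ε u : ℝ) : EReal)

/-- The problem is finite at `(l, ξ)`. -/
def IsFiniteAt (M : Problem Ω n m) (μ : Measure Ω) (w : ℕ → Ω → ℝ) (l : ℕ)
    (ξ : Ω → Fin n → ℝ) : Prop :=
  ⊥ < M.value μ w l ξ

/-- `J⁰(l, 0; u) ≥ 0` for all admissible `u`. -/
def ConvexityCondition (M : Problem Ω n m) (μ : Measure Ω) (w : ℕ → Ω → ℝ) (l : ℕ)
    (ξ : Ω → Fin n → ℝ) : Prop :=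
  ∀ u ∈ Admissible (m := m) μ w l M.N ξ, 0 ≤ M.homogeneous.cost μ w l (fun _ => 0) u

/-- `u` is an optimal control of the regularized problem at `(l, ξ)`. -/
def IsOptimalReg (M : Problem Ω n m) (μ : Measure Ω) (w : ℕ → Ω → ℝ) (l : ℕ)
    (ξ : Ω → Fin n → ℝ) (ε : ℝ) (u : ℕ → Ω → Fin m → ℝ) : Prop :=
  u ∈ Admissible (m := m) μ w l M.N ξ ∧
    ∀ v ∈ Admissible (m := m) μ w l M.N ξ, M.costReg μ w l ξ ε u ≤ M.costReg μ w l ξ ε v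

/-- The controls `u ε` are admissible and minimizing for `u ↦ J(l, ξ; u)` as `ε ↓ 0`. -/
def IsMinimizing (M : Problem Ω n m) (μ : Measure Ω) (w : ℕ → Ω → ℝ) (l : ℕ)
    (ξ : Ω → Fin n → ℝ) (u : ℝ → ℕ → Ω → Fin m → ℝ) : Prop :=
  (∀ ε, 0 < ε → u ε ∈ Admissible (m := m) μ w l M.N ξ) ∧
    Tendsto (fun ε => ((M.cost μ w l ξ (u ε) : ℝ) : EReal)) (𝓝[>] 0) (𝓝 (M.value μ w l ξ))

end Problem

namespace Problem

variable {Ω : Type*} {n m : ℕ}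

/-- `R + ε I + B' P B + D' P D` at time `k`, where `P` is the matrix for time `k + 1`. -/
def upsilonOf (M : Problem Ω n m) (ε : ℝ) (k : ℕ) (P : Matrix (Fin n) (Fin n) ℝ) :
    Matrix (Fin m) (Fin m) ℝ :=
  M.R k + ε • 1 + (M.B k)ᵀ * P * M.B k + (M.D k)ᵀ * P * M.D k

/-- `B' P A + D' P C + S` at time `k`. -/
def hOf (M : Problem Ω n m) (k : ℕ) (P : Matrix (Fin n) (Fin n) ℝ) : Matrix (Fin m) (Fin n) ℝ :=
  (M.B k)ᵀ * P * M.A k + (M.D k)ᵀ * P * M.C k + M.S k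

/-- `R + R̄ + ε I + (B + B̄)' Π (B + B̄) + (D + D̄)' P (D + D̄)` at time `k`. -/
def upsilonBarOf (M : Problem Ω n m) (ε : ℝ) (k : ℕ) (P Pi : Matrix (Fin n) (Fin n) ℝ) :
    Matrix (Fin m) (Fin m) ℝ :=
  M.R k + M.Rbar k + ε • 1 + (M.B k + M.Bbar k)ᵀ * Pi * (M.B k + M.Bbar k)
    + (M.D k + M.Dbar k)ᵀ * P * (M.D k + M.Dbar k)

/-- `(B + B̄)' Π (A + Ā) + (D + D̄)' P (C + C̄) + S + S̄` at time `k`. -/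
def hBarOf (M : Problem Ω n m) (k : ℕ) (P Pi : Matrix (Fin n) (Fin n) ℝ) :
    Matrix (Fin m) (Fin n) ℝ :=
  (M.B k + M.Bbar k)ᵀ * Pi * (M.A k + M.Abar k) + (M.D k + M.Dbar k)ᵀ * P * (M.C k + M.Cbar k)
    + M.S k + M.Sbar k

/-- The solution `(P^ε_k, Π^ε_k)` of the coupled generalized Riccati equations of the
regularized problem. -/
noncomputable def riccati (M : Problem Ω n m) (ε : ℝ) :
    ℕ → Matrix (Fin n) (Fin n) ℝ × Matrix (Fin n) (Fin n) ℝ :=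
  backward M.N (M.G, M.G + M.Gbar) fun k X =>
    (M.Q k + (M.A k)ᵀ * X.1 * M.A k + (M.C k)ᵀ * X.1 * M.C k
        - (M.hOf k X.1)ᵀ * (M.upsilonOf ε k X.1)⁻¹ * M.hOf k X.1,
      M.Q k + M.Qbar k + (M.A k + M.Abar k)ᵀ * X.2 * (M.A k + M.Abar k)
        + (M.C k + M.Cbar k)ᵀ * X.1 * (M.C k + M.Cbar k)
        - (M.hBarOf k X.1 X.2)ᵀ * (M.upsilonBarOf ε k X.1 X.2)⁻¹ * M.hBarOf k X.1 X.2)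

/-- `P^ε_k`. -/
noncomputable def ricP (M : Problem Ω n m) (ε : ℝ) (k : ℕ) : Matrix (Fin n) (Fin n) ℝ :=
  (M.riccati ε k).1

/-- `Π^ε_k`. -/
noncomputable def ricPi (M : Problem Ω n m) (ε : ℝ) (k : ℕ) : Matrix (Fin n) (Fin n) ℝ :=
  (M.riccati ε k).2

/-- `Υ^ε_k = R_k + ε I + B_k' P^ε_{k+1} B_k + D_k' P^ε_{k+1} D_k`. -/
noncomputable def upsilon (M : Problem Ω n m) (ε : ℝ) (k : ℕ) : Matrix (Fin m) (Fin m) ℝ :=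
  M.upsilonOf ε k (M.ricP ε (k + 1))

/-- The mean-field counterpart of `upsilon`. -/
noncomputable def upsilonBar (M : Problem Ω n m) (ε : ℝ) (k : ℕ) : Matrix (Fin m) (Fin m) ℝ :=
  M.upsilonBarOf ε k (M.ricP ε (k + 1)) (M.ricPi ε (k + 1))

/-- The gain `Θ^ε_k`. -/
noncomputable def theta (M : Problem Ω n m) (ε : ℝ) (k : ℕ) : Matrix (Fin m) (Fin n) ℝ :=
  -((M.upsilon ε k)⁻¹ * M.hOf k (M.ricP ε (k + 1)))

/-- The gain `Θ̄^ε_k`. -/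
noncomputable def thetaBar (M : Problem Ω n m) (ε : ℝ) (k : ℕ) : Matrix (Fin m) (Fin n) ℝ :=
  -((M.upsilonBar ε k)⁻¹ * M.hBarOf k (M.ricP ε (k + 1)) (M.ricPi ε (k + 1)))

variable [MeasurableSpace Ω]

/-- `(D + D̄)' P^ε_{k+1} σ + (B + B̄)' (Π^ε_{k+1} b + η) + ρ + ρ̄` at time `k`, the weights
`ρ` and `ρ̄` entering through their means. -/
noncomputable def zetaOf (M : Problem Ω n m) (μ : Measure Ω) (ε : ℝ) (k : ℕ) (η : Fin n → ℝ) :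
    Fin m → ℝ :=
  (M.D k + M.Dbar k)ᵀ *ᵥ (M.ricP ε (k + 1) *ᵥ M.σ k)
    + (M.B k + M.Bbar k)ᵀ *ᵥ (M.ricPi ε (k + 1) *ᵥ M.b k + η)
    + ∫ ω, M.ρ k ω ∂μ + ∫ ω, M.ρbar k ω ∂μ

/-- The solution `η^ε_k` of the linear recursive equation of the regularized problem. -/
noncomputable def eta (M : Problem Ω n m) (μ : Measure Ω) (ε : ℝ) : ℕ → Fin n → ℝ :=
  backward M.N (∫ ω, M.g ω ∂μ + ∫ ω, M.gbar ω ∂μ) fun k η =>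
    (M.C k + M.Cbar k)ᵀ *ᵥ (M.ricP ε (k + 1) *ᵥ M.σ k)
      + (M.A k + M.Abar k)ᵀ *ᵥ (M.ricPi ε (k + 1) *ᵥ M.b k + η)
      + ∫ ω, M.q k ω ∂μ + ∫ ω, M.qbar k ω ∂μ
      + (M.thetaBar ε k)ᵀ *ᵥ M.zetaOf μ ε k η

/-- The vector `v^ε_k`. -/
noncomputable def vOffset (M : Problem Ω n m) (μ : Measure Ω) (ε : ℝ) (k : ℕ) : Fin m → ℝ :=
  -((M.upsilonBar ε k)⁻¹ *ᵥ M.zetaOf μ ε k (M.eta μ ε (k + 1)))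

/-- The feedback law `x ↦ Θ^ε_k (x - 𝔼 x) + Θ̄^ε_k 𝔼 x + v^ε_k`. -/
noncomputable def feedbackLaw (M : Problem Ω n m) (μ : Measure Ω) (ε : ℝ) (k : ℕ)
    (x : Ω → Fin n → ℝ) : Ω → Fin m → ℝ := fun ω =>
  M.theta ε k *ᵥ (x ω - ∫ ω', x ω' ∂μ) + M.thetaBar ε k *ᵥ (∫ ω', x ω' ∂μ) + M.vOffset μ ε k

/-- The control `u^ε`: the feedback law evaluated along the closed-loop state it generates. -/
noncomputable def feedbackControl (M : Problem Ω n m) (μ : Measure Ω) (w : ℕ → Ω → ℝ) (l : ℕ)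
    (ξ : Ω → Fin n → ℝ) (ε : ℝ) : ℕ → Ω → Fin m → ℝ := fun k =>
  M.feedbackLaw μ ε k (M.trajectory μ w l ξ (M.feedbackLaw μ ε) k)

end Problem

end MFLQ

/-! The limit of the values is soft. Since $J\le J^\varepsilon$, one has $V\le V^\varepsilon$; for
fixed $u$, $V^\varepsilon\le J^\varepsilon(u)\to J(u)$, and $u$ can be chosen nearly optimal for $J$
(`tendsto_valueReg`). Controls optimal for $J^\varepsilon$ are then minimizing, because $V\le
J(u^\varepsilon)\le J^\varepsilon(u^\varepsilon)=V^\varepsilon\to V$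
(`isMinimizing_of_isOptimalReg`).

For the feedback, split states and controls into mean and deviation; second moments then have no
cross terms (`integral_quad_eq`). The noise has conditional mean 0 and variance 1, so drift and
diffusion decouple as well (`integral_quad_step`). Completing one square in the deviations and one
in the means gives `stageValue_step`: the value at `k + 1` plus the running cost equals the value at
`k`, plus a loss `gap` that is quadratic with weights $\Upsilon_k,\bar\Upsilon_k$, plus a constant.
Telescoping, $J^\varepsilon(u)$ is a term independent of $u$ plus the sum of the gaps. The gaps
vanish along the feedback and are nonnegative once the weights are positive.

Positivity follows from the convexity condition by backward induction. When the later weights are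
invertible, take the control that is 0 before time `k`, equal to `v` at `k`, and the homogeneous
feedback afterwards. Started from 0, its homogeneous regularized cost is exactly $\mathbb
E\langle\Upsilon_k(v-\mathbb Ev),v-\mathbb Ev\rangle+\langle\bar\Upsilon_k\mathbb Ev,\mathbb
Ev\rangle$, which is therefore at least $\varepsilon\mathbb E|v|^2$ (`regularized_quad_bound`).
Constant `v` bound $\bar\Upsilon_k$; centered `v` bound $\Upsilon_k$, provided the past carries a
nonconstant scalar. It does unless $k=l$ and $\xi$ is a.s. constant. In that case state and control
at time $l$ have no deviation, so $\Upsilon_l$ plays no role; this explains the disjunctive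
hypotheses in the lemmas below. -/

namespace MFLQ

variable {Ω : Type*}

/-! ### Conditional moments of the noise. -/

section Noise

variable {𝒢 m0 : MeasurableSpace Ω} {μ : Measure Ω} [IsProbabilityMeasure μ] {w z y : Ω → ℝ}

/-- Unit conditional variance says that `μ` and the measure with density `w ^ 2` agree on `𝒢`. The
form with `∫⁻` presupposes no integrability of the product, and so can be used to prove it. -/
theorem lintegral_mul_noise_sq (h𝒢 : 𝒢 ≤ m0) (hwm : Measurable w) (hw : MemLp w 2 μ)
    (hw2 : μ[fun ω => w ω ^ 2 | 𝒢] =ᵐ[μ] fun _ => (1 : ℝ)) {f : Ω → ENNReal}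
    (hf : Measurable[𝒢] f) :
    ∫⁻ ω, ENNReal.ofReal (w ω ^ 2) * f ω ∂μ = ∫⁻ ω, f ω ∂μ := by
  have hdens : Measurable fun ω => ENNReal.ofReal (w ω ^ 2) := by fun_prop
  have htrim : (μ.withDensity fun ω => ENNReal.ofReal (w ω ^ 2)).trim h𝒢 = μ.trim h𝒢 := by
    refine @Measure.ext _ 𝒢 _ _ fun s hs => ?_
    rw [trim_measurableSet_eq h𝒢 hs, trim_measurableSet_eq h𝒢 hs, withDensity_apply _ (h𝒢 s hs),
      ← ofReal_integral_eq_lintegral_ofReal hw.integrable_sq.integrableOn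
        (Eventually.of_forall fun ω => sq_nonneg _),
      ← setIntegral_condExp h𝒢 hw.integrable_sq hs,
      setIntegral_congr_ae (h𝒢 s hs) (hw2.mono fun ω h _ => h)]
    simp
  have h1 := lintegral_withDensity_eq_lintegral_mul μ hdens (hf.mono h𝒢 le_rfl)
  rw [← lintegral_trim h𝒢 hf, htrim, lintegral_trim h𝒢 hf] at h1
  exact h1.symm

/-- Without independence, a product of two square integrable functions need not be square
integrable. Here the conditional variance turns the integral of $w^2z^2$ into that of $z^2$. -/
theorem memLp_noise_mul (h𝒢 : 𝒢 ≤ m0) (hwm : Measurable w) (hw : MemLp w 2 μ)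
    (hw2 : μ[fun ω => w ω ^ 2 | 𝒢] =ᵐ[μ] fun _ => (1 : ℝ))
    (hz : Measurable[𝒢] z) (hz2 : MemLp z 2 μ) : MemLp (fun ω => w ω * z ω) 2 μ := by
  have hzm : Measurable z := hz.mono h𝒢 le_rfl
  refine (memLp_two_iff_integrable_sq (hwm.mul hzm).aestronglyMeasurable).2
    ⟨by fun_prop, ?_⟩
  have h1 := hz2.integrable_sq.2
  rw [hasFiniteIntegral_iff_ofReal (Eventually.of_forall fun ω => sq_nonneg _)] at h1 ⊢
  have hf : Measurable[𝒢] fun ω => ENNReal.ofReal (z ω ^ 2) := (hz.pow_const 2).ennreal_ofReal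
  rw [← lintegral_mul_noise_sq h𝒢 hwm hw hw2 hf] at h1
  refine (lintegral_congr fun ω => ?_).trans_lt h1
  rw [← ENNReal.ofReal_mul (sq_nonneg _), Pi.mul_apply, mul_pow]

theorem integral_noise_mul (h𝒢 : 𝒢 ≤ m0) (hwm : Measurable w) (hw : MemLp w 2 μ)
    (hw1 : μ[w | 𝒢] =ᵐ[μ] fun _ => (0 : ℝ))
    (hw2 : μ[fun ω => w ω ^ 2 | 𝒢] =ᵐ[μ] fun _ => (1 : ℝ))
    (hz : Measurable[𝒢] z) (hz2 : MemLp z 2 μ) (hy : Measurable[𝒢] y) (hy2 : MemLp y 2 μ) :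
    ∫ ω, w ω * (z ω * y ω) ∂μ = 0 := by
  -- Pulling `z * y` out of the conditional expectation needs this integrability; it holds because
  -- `w * z` and `y` are both in $L^2$.
  have hint : Integrable ((fun ω => z ω * y ω) * w) μ := by
    refine ((memLp_noise_mul h𝒢 hwm hw hw2 hz hz2).integrable_mul hy2).congr
      (Eventually.of_forall fun ω => ?_)
    simp only [Pi.mul_apply]; ring
  have h := condExp_mul_of_stronglyMeasurable_left (m := 𝒢) (f := fun ω => z ω * y ω)
    (hz.mul hy).stronglyMeasurable hint
    (hw.integrable (by norm_num))
  calc ∫ ω, w ω * (z ω * y ω) ∂μ = ∫ ω, ((fun ω => z ω * y ω) * w) ω ∂μ := by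
        congr 1; ext ω; simp only [Pi.mul_apply]; ring
    _ = ∫ ω, μ[(fun ω => z ω * y ω) * w | 𝒢] ω ∂μ := (integral_condExp h𝒢).symm
    _ = ∫ ω, (0 : ℝ) ∂μ := by
        refine integral_congr_ae ?_
        filter_upwards [h, hw1] with ω h h1
        rw [h, Pi.mul_apply, h1, mul_zero]
    _ = 0 := by simp

theorem integral_noise_sq_mul (h𝒢 : 𝒢 ≤ m0) (hwm : Measurable w) (hw : MemLp w 2 μ)
    (hw2 : μ[fun ω => w ω ^ 2 | 𝒢] =ᵐ[μ] fun _ => (1 : ℝ))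
    (hz : Measurable[𝒢] z) (hz2 : MemLp z 2 μ) (hy : Measurable[𝒢] y) (hy2 : MemLp y 2 μ) :
    ∫ ω, (w ω * z ω) * (w ω * y ω) ∂μ = ∫ ω, z ω * y ω ∂μ := by
  have hint : Integrable ((fun ω => z ω * y ω) * fun ω => w ω ^ 2) μ := by
    refine ((memLp_noise_mul h𝒢 hwm hw hw2 hz hz2).integrable_mul
      (memLp_noise_mul h𝒢 hwm hw hw2 hy hy2)).congr (Eventually.of_forall fun ω => ?_)
    simp only [Pi.mul_apply]; ring
  have h := condExp_mul_of_stronglyMeasurable_left (m := 𝒢) (f := fun ω => z ω * y ω)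
    (hz.mul hy).stronglyMeasurable hint
    hw.integrable_sq
  calc ∫ ω, (w ω * z ω) * (w ω * y ω) ∂μ
      = ∫ ω, ((fun ω => z ω * y ω) * fun ω => w ω ^ 2) ω ∂μ := by
        congr 1; ext ω; simp only [Pi.mul_apply]; ring
    _ = ∫ ω, μ[(fun ω => z ω * y ω) * fun ω => w ω ^ 2 | 𝒢] ω ∂μ := (integral_condExp h𝒢).symm
    _ = ∫ ω, z ω * y ω ∂μ := by
        refine integral_congr_ae ?_
        filter_upwards [h, hw2] with ω h h1
        rw [h, Pi.mul_apply, h1, mul_one]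

theorem integral_noise (h𝒢 : 𝒢 ≤ m0) (hw1 : μ[w | 𝒢] =ᵐ[μ] fun _ => (0 : ℝ)) :
    ∫ ω, w ω ∂μ = 0 := by
  rw [← integral_condExp h𝒢, integral_congr_ae hw1]; simp

theorem integral_noise_sq (h𝒢 : 𝒢 ≤ m0)
    (hw2 : μ[fun ω => w ω ^ 2 | 𝒢] =ᵐ[μ] fun _ => (1 : ℝ)) :
    ∫ ω, w ω ^ 2 ∂μ = 1 := by
  rw [← integral_condExp h𝒢, integral_congr_ae hw2]; simp

end Noise

/-! ### Second moments of random vectors, split into mean and deviation. -/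

section Vectors

theorem integral_add_four [MeasurableSpace Ω] {μ : Measure Ω} {f₁ f₂ f₃ f₄ : Ω → ℝ}
    (h₁ : Integrable f₁ μ) (h₂ : Integrable f₂ μ) (h₃ : Integrable f₃ μ) (h₄ : Integrable f₄ μ) :
    ∫ ω, (f₁ ω + f₂ ω + f₃ ω + f₄ ω) ∂μ
      = ∫ ω, f₁ ω ∂μ + ∫ ω, f₂ ω ∂μ + ∫ ω, f₃ ω ∂μ + ∫ ω, f₄ ω ∂μ := by
  have e : ∀ ω, f₁ ω + f₂ ω + f₃ ω + f₄ ω = (f₁ + f₂ + f₃ + f₄) ω := fun _ => rfl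
  simp only [e]
  rw [integral_add' ((h₁.add h₂).add h₃) h₄, integral_add' (h₁.add h₂) h₃, integral_add' h₁ h₂]

variable [m0 : MeasurableSpace Ω] {μ : Measure Ω} {a b : ℕ}

theorem integrable_dotProduct {x y : Ω → Fin a → ℝ} (hx : MemLp x 2 μ) (hy : MemLp y 2 μ) :
    Integrable (fun ω => x ω ⬝ᵥ y ω) μ := by
  simp only [dotProduct]
  exact integrable_finsetSum _ fun i _ => (hx.eval i).integrable_mul (hy.eval i)

theorem integral_dotProduct {x y : Ω → Fin a → ℝ} (hx : MemLp x 2 μ) (hy : MemLp y 2 μ) :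
    ∫ ω, x ω ⬝ᵥ y ω ∂μ = ∑ i, ∫ ω, x ω i * y ω i ∂μ :=
  integral_finsetSum _ fun i _ => (hx.eval i).integrable_mul (hy.eval i)

theorem memLp_mulVec (P : Matrix (Fin a) (Fin b) ℝ) {x : Ω → Fin b → ℝ} (hx : MemLp x 2 μ) :
    MemLp (fun ω => P *ᵥ x ω) 2 μ :=
  hx.continuousLinearMap_comp (LinearMap.toContinuousLinearMap P.mulVecLin)

theorem integrable_quad (P : Matrix (Fin a) (Fin b) ℝ) {x : Ω → Fin b → ℝ} {y : Ω → Fin a → ℝ}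
    (hx : MemLp x 2 μ) (hy : MemLp y 2 μ) : Integrable (fun ω => (P *ᵥ x ω) ⬝ᵥ y ω) μ :=
  integrable_dotProduct (memLp_mulVec P hx) hy

variable [IsProbabilityMeasure μ]

theorem integral_mulVec (P : Matrix (Fin a) (Fin b) ℝ) {x : Ω → Fin b → ℝ} (hx : MemLp x 2 μ) :
    ∫ ω, P *ᵥ x ω ∂μ = P *ᵥ ∫ ω, x ω ∂μ :=
  (LinearMap.toContinuousLinearMap P.mulVecLin).integral_comp_comm (hx.integrable (by norm_num))

theorem integral_const_dotProduct (c : Fin a → ℝ) {x : Ω → Fin a → ℝ} (hx : MemLp x 2 μ) :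
    ∫ ω, c ⬝ᵥ x ω ∂μ = c ⬝ᵥ ∫ ω, x ω ∂μ := by
  have hi := fun i => (hx.eval i).integrable (by norm_num)
  simp only [dotProduct]
  rw [integral_finsetSum _ fun i _ => (hi i).const_mul _]
  exact Finset.sum_congr rfl fun i _ => by rw [integral_const_mul, eval_integral hi]

theorem integral_dotProduct_const (c : Fin a → ℝ) {x : Ω → Fin a → ℝ} (hx : MemLp x 2 μ) :
    ∫ ω, x ω ⬝ᵥ c ∂μ = (∫ ω, x ω ∂μ) ⬝ᵥ c := by
  simp only [dotProduct_comm _ c]; exact integral_const_dotProduct c hx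

/-- The deviation of a random vector from its mean. -/
noncomputable def centered (μ : Measure Ω) (x : Ω → Fin a → ℝ) : Ω → Fin a → ℝ := fun ω =>
  x ω - ∫ ω', x ω' ∂μ

theorem memLp_centered {x : Ω → Fin a → ℝ} (hx : MemLp x 2 μ) : MemLp (centered μ x) 2 μ :=
  hx.sub (memLp_const _)

theorem integral_centered {x : Ω → Fin a → ℝ} (hx : MemLp x 2 μ) :
    ∫ ω, centered μ x ω ∂μ = 0 := by
  simp only [centered]
  rw [integral_sub (hx.integrable (by norm_num)) (integrable_const _)]; simp

/-- A bilinear second moment splits into the centered second moment and the means. -/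
theorem integral_quad_eq (P : Matrix (Fin a) (Fin b) ℝ) {x : Ω → Fin b → ℝ} {y : Ω → Fin a → ℝ}
    (hx : MemLp x 2 μ) (hy : MemLp y 2 μ) :
    ∫ ω, (P *ᵥ x ω) ⬝ᵥ y ω ∂μ = ∫ ω, (P *ᵥ centered μ x ω) ⬝ᵥ centered μ y ω ∂μ
      + (P *ᵥ ∫ ω, x ω ∂μ) ⬝ᵥ ∫ ω, y ω ∂μ := by
  set X := ∫ ω, x ω ∂μ with hX
  set Y := ∫ ω, y ω ∂μ with hY
  have hxc := memLp_centered hx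
  have hyc := memLp_centered hy
  have h : ∀ ω, (P *ᵥ x ω) ⬝ᵥ y ω = (P *ᵥ centered μ x ω) ⬝ᵥ centered μ y ω
      + (P *ᵥ centered μ x ω) ⬝ᵥ Y + (P *ᵥ X) ⬝ᵥ centered μ y ω + (P *ᵥ X) ⬝ᵥ Y := fun ω => by
    have h1 : x ω = centered μ x ω + X := by simp [centered, hX]
    have h2 : y ω = centered μ y ω + Y := by simp [centered, hY]
    conv_lhs => rw [h1, h2]
    simp only [Matrix.mulVec_add, add_dotProduct, dotProduct_add]; ring
  simp only [h]
  have i1 := integrable_quad P hxc hyc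
  have i2 := integrable_quad P hxc (memLp_const Y)
  have i3 := integrable_quad P (memLp_const X) hyc
  rw [integral_add_four i1 i2 i3 (integrable_const _), integral_dotProduct_const Y (memLp_mulVec P hxc),
    integral_mulVec P hxc, integral_const_dotProduct _ hyc, integral_centered hx,
    integral_centered hy]
  simp

end Vectors

/-! ### Nonanticipative random vectors multiplied by the noise. -/

/-- Square integrable random vectors that are measurable with respect to `𝒢`. -/
structure IsL2 [MeasurableSpace Ω] (μ : Measure Ω) (𝒢 : MeasurableSpace Ω) {a : ℕ}
    (x : Ω → Fin a → ℝ) : Prop where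
  meas : Measurable[𝒢] x
  memLp : MemLp x 2 μ

namespace IsL2

variable {𝒢 ℋ : MeasurableSpace Ω} [m0 : MeasurableSpace Ω] {μ : Measure Ω}
  {a b : ℕ} {x y : Ω → Fin a → ℝ}

theorem eval_meas (hx : IsL2 μ 𝒢 x) (i : Fin a) : Measurable[𝒢] fun ω => x ω i :=
  (measurable_pi_apply i).comp hx.meas

theorem add (hx : IsL2 μ 𝒢 x) (hy : IsL2 μ 𝒢 y) : IsL2 μ 𝒢 fun ω => x ω + y ω :=
  ⟨hx.meas.add hy.meas, hx.memLp.add hy.memLp⟩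

theorem sub (hx : IsL2 μ 𝒢 x) (hy : IsL2 μ 𝒢 y) : IsL2 μ 𝒢 fun ω => x ω - y ω :=
  ⟨hx.meas.sub hy.meas, hx.memLp.sub hy.memLp⟩

theorem mulVec (P : Matrix (Fin b) (Fin a) ℝ) (hx : IsL2 μ 𝒢 x) : IsL2 μ 𝒢 fun ω => P *ᵥ x ω :=
  ⟨(LinearMap.toContinuousLinearMap P.mulVecLin).continuous.measurable.comp hx.meas,
    memLp_mulVec P hx.memLp⟩

theorem mono (h : 𝒢 ≤ ℋ) (hx : IsL2 μ 𝒢 x) : IsL2 μ ℋ x := ⟨hx.meas.mono h le_rfl, hx.memLp⟩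

theorem smul_const {s : Ω → ℝ} (hs : Measurable[𝒢] s) (hs2 : MemLp s 2 μ) (v : Fin a → ℝ) :
    IsL2 μ 𝒢 fun ω => s ω • v :=
  ⟨@measurable_pi_lambda _ _ _ 𝒢 _ _ fun i => hs.mul_const (v i),
    MemLp.of_eval fun i => (hs2.mul_const (v i))⟩

variable [IsProbabilityMeasure μ]

theorem const (c : Fin a → ℝ) : IsL2 μ 𝒢 fun _ => c := ⟨measurable_const, memLp_const c⟩

theorem centered (hx : IsL2 μ 𝒢 x) : IsL2 μ 𝒢 (centered μ x) := hx.sub (const _)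

variable {w : Ω → ℝ}

theorem memLp_noise_smul (h𝒢 : 𝒢 ≤ m0) (hwm : Measurable w) (hw : MemLp w 2 μ)
    (hw2 : μ[fun ω => w ω ^ 2 | 𝒢] =ᵐ[μ] fun _ => (1 : ℝ)) (hx : IsL2 μ 𝒢 x) :
    MemLp (fun ω => w ω • x ω) 2 μ :=
  MemLp.of_eval fun i =>
    memLp_noise_mul h𝒢 hwm hw hw2 (hx.eval_meas i) (hx.memLp.eval i)

theorem integral_noise_smul (h𝒢 : 𝒢 ≤ m0) (hwm : Measurable w) (hw : MemLp w 2 μ)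
    (hw1 : μ[w | 𝒢] =ᵐ[μ] fun _ => (0 : ℝ))
    (hw2 : μ[fun ω => w ω ^ 2 | 𝒢] =ᵐ[μ] fun _ => (1 : ℝ)) (hx : IsL2 μ 𝒢 x) :
    ∫ ω, w ω • x ω ∂μ = 0 := by
  have hL := memLp_noise_smul h𝒢 hwm hw hw2 hx
  ext i
  rw [eval_integral fun i => (hL.eval i).integrable (by norm_num)]
  have := integral_noise_mul h𝒢 hwm hw hw1 hw2 (hx.eval_meas i) (hx.memLp.eval i)
    (y := fun _ => 1) measurable_const (memLp_const _)
  simpa using this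

theorem integral_noise_mul_dotProduct (h𝒢 : 𝒢 ≤ m0) (hwm : Measurable w) (hw : MemLp w 2 μ)
    (hw1 : μ[w | 𝒢] =ᵐ[μ] fun _ => (0 : ℝ))
    (hw2 : μ[fun ω => w ω ^ 2 | 𝒢] =ᵐ[μ] fun _ => (1 : ℝ)) (hx : IsL2 μ 𝒢 x) (hy : IsL2 μ 𝒢 y) :
    ∫ ω, (w ω • x ω) ⬝ᵥ y ω ∂μ = 0 := by
  have hL := memLp_noise_smul h𝒢 hwm hw hw2 hx
  rw [integral_dotProduct hL hy.memLp]
  refine Finset.sum_eq_zero fun i _ => ?_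
  simpa [mul_assoc] using
    integral_noise_mul h𝒢 hwm hw hw1 hw2 (hx.eval_meas i) (hx.memLp.eval i)
      (hy.eval_meas i) (hy.memLp.eval i)

theorem integral_noise_sq_mul_dotProduct (h𝒢 : 𝒢 ≤ m0) (hwm : Measurable w) (hw : MemLp w 2 μ)
    (hw2 : μ[fun ω => w ω ^ 2 | 𝒢] =ᵐ[μ] fun _ => (1 : ℝ)) (hx : IsL2 μ 𝒢 x) (hy : IsL2 μ 𝒢 y) :
    ∫ ω, (w ω • x ω) ⬝ᵥ (w ω • y ω) ∂μ = ∫ ω, x ω ⬝ᵥ y ω ∂μ := by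
  have hL := memLp_noise_smul h𝒢 hwm hw hw2 hx
  have hL' := memLp_noise_smul h𝒢 hwm hw hw2 hy
  rw [integral_dotProduct hL hL', integral_dotProduct hx.memLp hy.memLp]
  exact Finset.sum_congr rfl fun i _ =>
    integral_noise_sq_mul h𝒢 hwm hw hw2 (hx.eval_meas i) (hx.memLp.eval i)
      (hy.eval_meas i) (hy.memLp.eval i)

/-- The noise decouples the two parts of a second moment. -/
theorem integral_quad_add_noise (h𝒢 : 𝒢 ≤ m0) (hwm : Measurable w) (hw : MemLp w 2 μ)
    (hw1 : μ[w | 𝒢] =ᵐ[μ] fun _ => (0 : ℝ))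
    (hw2 : μ[fun ω => w ω ^ 2 | 𝒢] =ᵐ[μ] fun _ => (1 : ℝ)) (P : Matrix (Fin a) (Fin a) ℝ)
    (hx : IsL2 μ 𝒢 x) (hy : IsL2 μ 𝒢 y) :
    ∫ ω, (P *ᵥ (x ω + w ω • y ω)) ⬝ᵥ (x ω + w ω • y ω) ∂μ
      = ∫ ω, (P *ᵥ x ω) ⬝ᵥ x ω ∂μ + ∫ ω, (P *ᵥ y ω) ⬝ᵥ y ω ∂μ := by
  have hwy := memLp_noise_smul h𝒢 hwm hw hw2 hy
  have hwPy := memLp_noise_smul h𝒢 hwm hw hw2 (hy.mulVec P)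
  have h : ∀ ω, (P *ᵥ (x ω + w ω • y ω)) ⬝ᵥ (x ω + w ω • y ω)
      = (P *ᵥ x ω) ⬝ᵥ x ω + (w ω • (P *ᵥ y ω)) ⬝ᵥ (w ω • y ω) + (w ω • y ω) ⬝ᵥ (P *ᵥ x ω)
        + (w ω • (P *ᵥ y ω)) ⬝ᵥ x ω := fun ω => by
    simp only [Matrix.mulVec_add, Matrix.mulVec_smul, add_dotProduct, dotProduct_add]
    rw [dotProduct_comm (w ω • y ω) (P *ᵥ x ω)]; ring
  simp only [h]
  have i1 := integrable_quad P hx.memLp hx.memLp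
  have i2 := integrable_dotProduct hwPy hwy
  have i3 := integrable_dotProduct hwy (memLp_mulVec P hx.memLp)
  have i4 := integrable_dotProduct hwPy hx.memLp
  rw [integral_add_four i1 i2 i3 i4,
    integral_noise_sq_mul_dotProduct h𝒢 hwm hw hw2 (hy.mulVec P) hy,
    integral_noise_mul_dotProduct h𝒢 hwm hw hw1 hw2 hy (hx.mulVec P),
    integral_noise_mul_dotProduct h𝒢 hwm hw hw1 hw2 (hy.mulVec P) hx]
  ring

end IsL2

end MFLQ

/-! ### Linear algebra: completing the square, positive semidefiniteness. -/

namespace MFLQ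

section Algebra

variable {n m : ℕ}

theorem quad_comm {P : Matrix (Fin n) (Fin n) ℝ} (hP : P.IsSymm) (x y : Fin n → ℝ) :
    (P *ᵥ x) ⬝ᵥ y = (P *ᵥ y) ⬝ᵥ x := by
  rw [dotProduct_comm, Matrix.dotProduct_mulVec, ← Matrix.mulVec_transpose, hP.eq]

theorem transpose_mulVec_dotProduct (A : Matrix (Fin n) (Fin m) ℝ) (x : Fin n → ℝ)
    (y : Fin m → ℝ) : (Aᵀ *ᵥ x) ⬝ᵥ y = x ⬝ᵥ (A *ᵥ y) := by
  rw [Matrix.mulVec_transpose, Matrix.dotProduct_mulVec]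

theorem isSymm_conj {P : Matrix (Fin n) (Fin n) ℝ} (hP : P.IsSymm)
    (A : Matrix (Fin n) (Fin m) ℝ) : (Aᵀ * P * A).IsSymm := by
  simp [Matrix.IsSymm, Matrix.transpose_mul, hP.eq, Matrix.mul_assoc]

theorem isSymm_inv {U : Matrix (Fin m) (Fin m) ℝ} (hU : U.IsSymm) : (U⁻¹).IsSymm := by
  rw [Matrix.IsSymm, Matrix.transpose_nonsing_inv, hU.eq]

/-- Completion of the square. -/
theorem complete_square {U : Matrix (Fin m) (Fin m) ℝ} (hU : U.IsSymm) (hdet : IsUnit U.det)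
    (H : Matrix (Fin m) (Fin n) ℝ) (z : Fin m → ℝ) (x : Fin n → ℝ) (u : Fin m → ℝ) :
    (U *ᵥ u) ⬝ᵥ u + 2 * ((H *ᵥ x) ⬝ᵥ u) + 2 * (z ⬝ᵥ u)
      = (U *ᵥ (u - -(U⁻¹ * H) *ᵥ x - -(U⁻¹ *ᵥ z))) ⬝ᵥ (u - -(U⁻¹ * H) *ᵥ x - -(U⁻¹ *ᵥ z))
        - ((Hᵀ * U⁻¹ * H) *ᵥ x) ⬝ᵥ x + 2 * (((-(U⁻¹ * H))ᵀ *ᵥ z) ⬝ᵥ x)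
        + z ⬝ᵥ (-(U⁻¹ *ᵥ z)) := by
  -- The linear terms in `u` combine into `2 * (p ⬝ᵥ u)`, so the square is centered at `-(U⁻¹ *ᵥ
  -- p)`. Invertibility suffices; the sign of `U` does not matter.
  set p := H *ᵥ x + z with hp
  have h1 : u - -(U⁻¹ * H) *ᵥ x - -(U⁻¹ *ᵥ z) = u + U⁻¹ *ᵥ p := by
    rw [hp, Matrix.mulVec_add, Matrix.neg_mulVec, Matrix.mulVec_mulVec]; abel
  have h2 : U *ᵥ (U⁻¹ *ᵥ p) = p := by
    rw [Matrix.mulVec_mulVec, Matrix.mul_nonsing_inv _ hdet, Matrix.one_mulVec]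
  have h3 : ((Hᵀ * U⁻¹ * H) *ᵥ x) ⬝ᵥ x = (U⁻¹ *ᵥ (H *ᵥ x)) ⬝ᵥ (H *ᵥ x) := by
    rw [Matrix.mul_assoc, ← Matrix.mulVec_mulVec, transpose_mulVec_dotProduct,
      ← Matrix.mulVec_mulVec]
  have h4 : ((-(U⁻¹ * H))ᵀ *ᵥ z) ⬝ᵥ x = -((U⁻¹ *ᵥ (H *ᵥ x)) ⬝ᵥ z) := by
    rw [transpose_mulVec_dotProduct, Matrix.neg_mulVec, ← Matrix.mulVec_mulVec, dotProduct_neg,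
      dotProduct_comm]
  have h5 : (U *ᵥ u) ⬝ᵥ (U⁻¹ *ᵥ p) = p ⬝ᵥ u := by rw [quad_comm hU, h2]
  have h6 := quad_comm (isSymm_inv hU) (H *ᵥ x) z
  have h7 : p ⬝ᵥ u = (H *ᵥ x) ⬝ᵥ u + z ⬝ᵥ u := by rw [hp, add_dotProduct]
  have h8 : p ⬝ᵥ (U⁻¹ *ᵥ p) = (U⁻¹ *ᵥ (H *ᵥ x)) ⬝ᵥ (H *ᵥ x) + 2 * ((U⁻¹ *ᵥ (H *ᵥ x)) ⬝ᵥ z)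
      + z ⬝ᵥ (U⁻¹ *ᵥ z) := by
    rw [dotProduct_comm, hp, Matrix.mulVec_add, add_dotProduct, dotProduct_add, dotProduct_add,
      ← h6, dotProduct_comm z]; ring
  rw [h1, Matrix.mulVec_add, h2, add_dotProduct, dotProduct_add, dotProduct_add, h5, h8, h7, h3,
    h4, dotProduct_neg]
  ring

/-- Expansion of one step of the cost: `F` is the weight of the drift and `P` the weight of the
diffusion. -/
theorem step_expand {F P Q : Matrix (Fin n) (Fin n) ℝ} (hF : F.IsSymm) (hP : P.IsSymm)
    (A C : Matrix (Fin n) (Fin n) ℝ) (B D : Matrix (Fin n) (Fin m) ℝ)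
    (S : Matrix (Fin m) (Fin n) ℝ) (R : Matrix (Fin m) (Fin m) ℝ) (b σ h q : Fin n → ℝ)
    (r : Fin m → ℝ) (x : Fin n → ℝ) (u : Fin m → ℝ) :
    (F *ᵥ (A *ᵥ x + B *ᵥ u + b)) ⬝ᵥ (A *ᵥ x + B *ᵥ u + b) + 2 * (h ⬝ᵥ (A *ᵥ x + B *ᵥ u + b))
      + (P *ᵥ (C *ᵥ x + D *ᵥ u + σ)) ⬝ᵥ (C *ᵥ x + D *ᵥ u + σ)
      + ((Q *ᵥ x) ⬝ᵥ x + 2 * ((S *ᵥ x) ⬝ᵥ u) + (R *ᵥ u) ⬝ᵥ u + 2 * (q ⬝ᵥ x) + 2 * (r ⬝ᵥ u))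
    = ((Q + Aᵀ * F * A + Cᵀ * P * C) *ᵥ x) ⬝ᵥ x
      + 2 * ((Cᵀ *ᵥ (P *ᵥ σ) + Aᵀ *ᵥ (F *ᵥ b + h) + q) ⬝ᵥ x)
      + (((R + Bᵀ * F * B + Dᵀ * P * D) *ᵥ u) ⬝ᵥ u
        + 2 * (((Bᵀ * F * A + Dᵀ * P * C + S) *ᵥ x) ⬝ᵥ u)
        + 2 * ((Dᵀ *ᵥ (P *ᵥ σ) + Bᵀ *ᵥ (F *ᵥ b + h) + r) ⬝ᵥ u))
      + ((F *ᵥ b) ⬝ᵥ b + 2 * (h ⬝ᵥ b) + (P *ᵥ σ) ⬝ᵥ σ) := by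
  simp only [Matrix.add_mulVec, Matrix.mulVec_add, add_dotProduct, dotProduct_add, Matrix.mul_assoc,
    ← Matrix.mulVec_mulVec, transpose_mulVec_dotProduct]
  rw [quad_comm hF (B *ᵥ u) (A *ᵥ x), quad_comm hF (A *ᵥ x) b, quad_comm hF (B *ᵥ u) b,
    quad_comm hP (D *ᵥ u) (C *ᵥ x), quad_comm hP (C *ᵥ x) σ, quad_comm hP (D *ᵥ u) σ]
  ring

theorem posDef_of_sub_smul_one {U : Matrix (Fin m) (Fin m) ℝ} {ε : ℝ} (hε : 0 < ε)
    (h : (U - ε • 1).PosSemidef) : U.PosDef := by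
  have h1 : (ε • (1 : Matrix (Fin m) (Fin m) ℝ)).PosDef := Matrix.PosDef.one.smul hε
  have := h1.posSemidef_add h
  simpa using this

theorem quad_nonneg {U : Matrix (Fin m) (Fin m) ℝ} (h : U.PosSemidef) (u : Fin m → ℝ) :
    0 ≤ (U *ᵥ u) ⬝ᵥ u := by
  have := h.dotProduct_mulVec_nonneg u
  rwa [star_trivial, dotProduct_comm] at this

theorem posSemidef_of_quad_nonneg {U : Matrix (Fin m) (Fin m) ℝ} (hU : U.IsSymm)
    (h : ∀ u, 0 ≤ (U *ᵥ u) ⬝ᵥ u) : U.PosSemidef := by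
  refine Matrix.PosSemidef.of_dotProduct_mulVec_nonneg ?_ fun u => ?_
  · rw [Matrix.IsHermitian, Matrix.conjTranspose_eq_transpose_of_trivial, hU.eq]
  · rw [star_trivial, dotProduct_comm]; exact h u

end Algebra

/-! ### The Riccati recursion and the symmetry of its solution. -/

namespace Problem

variable {Ω : Type*} {n m : ℕ} (M : Problem Ω n m) (ε : ℝ)

theorem ricP_eq {k : ℕ} (hk : k < M.N) :
    M.ricP ε k = M.Q k + (M.A k)ᵀ * M.ricP ε (k + 1) * M.A k
      + (M.C k)ᵀ * M.ricP ε (k + 1) * M.C k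
      - (M.hOf k (M.ricP ε (k + 1)))ᵀ * (M.upsilon ε k)⁻¹ * M.hOf k (M.ricP ε (k + 1)) := by
  rw [ricP, riccati, backward_step _ _ _ hk]; rfl

theorem ricPi_eq {k : ℕ} (hk : k < M.N) :
    M.ricPi ε k = M.Q k + M.Qbar k
      + (M.A k + M.Abar k)ᵀ * M.ricPi ε (k + 1) * (M.A k + M.Abar k)
      + (M.C k + M.Cbar k)ᵀ * M.ricP ε (k + 1) * (M.C k + M.Cbar k)
      - (M.hBarOf k (M.ricP ε (k + 1)) (M.ricPi ε (k + 1)))ᵀ * (M.upsilonBar ε k)⁻¹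
        * M.hBarOf k (M.ricP ε (k + 1)) (M.ricPi ε (k + 1)) := by
  rw [ricPi, riccati, backward_step _ _ _ hk]; rfl

theorem smul_one_symm : (ε • (1 : Matrix (Fin m) (Fin m) ℝ)).IsSymm :=
  Matrix.isSymm_one.smul ε

theorem upsilonOf_symm (k : ℕ) {P : Matrix (Fin n) (Fin n) ℝ}
    (hP : P.IsSymm) : (M.upsilonOf ε k P).IsSymm :=
  (((M.R_symm k).add (smul_one_symm ε)).add (isSymm_conj hP _)).add (isSymm_conj hP _)

theorem upsilonBarOf_symm (k : ℕ) {P Pi : Matrix (Fin n) (Fin n) ℝ}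
    (hP : P.IsSymm) (hPi : Pi.IsSymm) : (M.upsilonBarOf ε k P Pi).IsSymm :=
  ((((M.R_symm k).add (M.Rbar_symm k)).add (smul_one_symm ε)).add (isSymm_conj hPi _)).add
    (isSymm_conj hP _)

theorem riccati_symm {k : ℕ} (hk : k ≤ M.N) :
    (M.ricP ε k).IsSymm ∧ (M.ricPi ε k).IsSymm := by
  induction hk using Nat.decreasingInduction with
  | self =>
    simp only [ricP, ricPi, riccati, backward_terminal]
    exact ⟨M.G_symm, M.G_symm.add M.Gbar_symm⟩
  | of_succ k hk ih =>
    have h1 := isSymm_conj (m := n) ih.1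
    have h2 := isSymm_conj (m := n) ih.2
    rw [ricP_eq M ε hk, ricPi_eq M ε hk]
    exact ⟨(((M.Q_symm k).add (h1 _)).add (h1 _)).sub
        (isSymm_conj (isSymm_inv (M.upsilonOf_symm ε k ih.1)) _),
      ((((M.Q_symm k).add (M.Qbar_symm k)).add (h2 _)).add (h1 _)).sub
        (isSymm_conj (isSymm_inv (M.upsilonBarOf_symm ε k ih.1 ih.2)) _)⟩

theorem upsilon_symm {k : ℕ} (hk : k < M.N) : (M.upsilon ε k).IsSymm :=
  M.upsilonOf_symm ε k (M.riccati_symm ε hk).1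

theorem upsilonBar_symm {k : ℕ} (hk : k < M.N) : (M.upsilonBar ε k).IsSymm :=
  M.upsilonBarOf_symm ε k (M.riccati_symm ε hk).1 (M.riccati_symm ε hk).2

end Problem

end MFLQ

/-! ### The filtration, and bookkeeping of integrals. -/

namespace MFLQ

variable {Ω : Type*}

section Past

variable {n : ℕ} {w : ℕ → Ω → ℝ} {l : ℕ} {ξ : Ω → Fin n → ℝ}

theorem past_mono {j k : ℕ} (h : j ≤ k) : past w l ξ j ≤ past w l ξ k :=
  sup_le_sup le_rfl (biSup_mono fun _ hi =>
    Finset.mem_Ico.2 ⟨(Finset.mem_Ico.1 hi).1, (Finset.mem_Ico.1 hi).2.trans_le h⟩)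

theorem measurable_past_init (k : ℕ) : Measurable[past w l ξ k] ξ :=
  (comap_measurable ξ).mono le_sup_left le_rfl

theorem measurable_past_noise {j k : ℕ} (hj : j ∈ Finset.Ico l k) :
    Measurable[past w l ξ k] (w j) :=
  (comap_measurable (w j)).mono
    ((le_biSup (fun j => MeasurableSpace.comap (w j) inferInstance) hj).trans le_sup_right) le_rfl

theorem past_le [m0 : MeasurableSpace Ω] {μ : Measure Ω} {N k : ℕ} (hξ : Measurable ξ)
    (hw : IsNoise μ w l N ξ) (hk : k ≤ N) : past w l ξ k ≤ m0 := by
  refine sup_le hξ.comap_le (iSup₂_le fun j hj => ?_)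
  have hj' := Finset.mem_Ico.1 hj
  exact (hw j (Finset.mem_Ico.2 ⟨hj'.1, hj'.2.trans_le hk⟩)).1.comap_le

end Past

/-- `f` is integrable with integral `a`. -/
def HasMean [MeasurableSpace Ω] (μ : Measure Ω) (f : Ω → ℝ) (a : ℝ) : Prop :=
  Integrable f μ ∧ ∫ ω, f ω ∂μ = a

namespace HasMean

variable [MeasurableSpace Ω] {μ : Measure Ω} {f g : Ω → ℝ} {a b : ℝ}

theorem of_integrable (hf : Integrable f μ) : HasMean μ f (∫ ω, f ω ∂μ) := ⟨hf, rfl⟩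

theorem add (hf : HasMean μ f a) (hg : HasMean μ g b) : HasMean μ (fun ω => f ω + g ω) (a + b) :=
  ⟨hf.1.add hg.1, by rw [integral_add hf.1 hg.1, hf.2, hg.2]⟩

theorem const_mul (c : ℝ) (hf : HasMean μ f a) : HasMean μ (fun ω => c * f ω) (c * a) :=
  ⟨hf.1.const_mul c, by rw [integral_const_mul, hf.2]⟩

theorem sum {s : Finset ℕ} {F : ℕ → Ω → ℝ} {A : ℕ → ℝ} (h : ∀ k ∈ s, HasMean μ (F k) (A k)) :
    HasMean μ (fun ω => ∑ k ∈ s, F k ω) (∑ k ∈ s, A k) :=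
  ⟨integrable_finsetSum _ fun k hk => (h k hk).1, by
    rw [integral_finsetSum _ fun k hk => (h k hk).1]
    exact Finset.sum_congr rfl fun k hk => (h k hk).2⟩

theorem const [IsProbabilityMeasure μ] (c : ℝ) : HasMean μ (fun _ => c) c :=
  ⟨integrable_const c, by simp⟩

theorem quad {p q : ℕ} (P : Matrix (Fin p) (Fin q) ℝ) {x : Ω → Fin q → ℝ} {y : Ω → Fin p → ℝ}
    (hx : MemLp x 2 μ) (hy : MemLp y 2 μ) :
    HasMean μ (fun ω => (P *ᵥ x ω) ⬝ᵥ y ω) (∫ ω, (P *ᵥ x ω) ⬝ᵥ y ω ∂μ) :=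
  of_integrable (integrable_quad P hx hy)

theorem dotProduct_const [IsProbabilityMeasure μ] {p : ℕ} {x : Ω → Fin p → ℝ} (hx : MemLp x 2 μ)
    (c : Fin p → ℝ) : HasMean μ (fun ω => x ω ⬝ᵥ c) ((∫ ω, x ω ∂μ) ⬝ᵥ c) :=
  ⟨integrable_dotProduct hx (memLp_const c), integral_dotProduct_const c hx⟩

/-- This is where a.s. constancy of the weights is used: a random weight correlated with the state
could not be replaced by its mean. -/
theorem dotProduct_of_const [IsProbabilityMeasure μ] {p : ℕ} {x y : Ω → Fin p → ℝ}
    (hx : MemLp x 2 μ) (hc : ∃ c, x =ᵐ[μ] fun _ => c) (hy : MemLp y 2 μ) :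
    HasMean μ (fun ω => x ω ⬝ᵥ y ω) ((∫ ω, x ω ∂μ) ⬝ᵥ ∫ ω, y ω ∂μ) := by
  obtain ⟨c, hc⟩ := hc
  refine ⟨integrable_dotProduct hx hy, ?_⟩
  rw [integral_congr_ae (hc.mono fun ω h => by simp only [h] :
    (fun ω => x ω ⬝ᵥ y ω) =ᵐ[μ] fun ω => c ⬝ᵥ y ω), integral_const_dotProduct c hy,
    integral_congr_ae hc]
  simp

end HasMean

theorem IsL2.affine {𝒢 : MeasurableSpace Ω} [MeasurableSpace Ω] {μ : Measure Ω}
    [IsProbabilityMeasure μ] {n m : ℕ} {x : Ω → Fin n → ℝ} {u : Ω → Fin m → ℝ}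
    (hx : IsL2 μ 𝒢 x) (hu : IsL2 μ 𝒢 u)
    (A A' : Matrix (Fin n) (Fin n) ℝ) (B B' : Matrix (Fin n) (Fin m) ℝ) (X : Fin n → ℝ)
    (U : Fin m → ℝ) (b : Fin n → ℝ) :
    IsL2 μ 𝒢 fun ω => A *ᵥ x ω + A' *ᵥ X + B *ᵥ u ω + B' *ᵥ U + b :=
  ((((hx.mulVec A).add (.const _)).add (hu.mulVec B)).add (.const _)).add (.const b)

/-! ### One step of the state equation: mean and centered second moment. -/

namespace Problem

variable {n m : ℕ} (M : Problem Ω n m) [m0 : MeasurableSpace Ω] {μ : Measure Ω}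
  [IsProbabilityMeasure μ] {w : ℕ → Ω → ℝ} {l : ℕ} {ξ : Ω → Fin n → ℝ}

section Step

variable {k : ℕ} {x : Ω → Fin n → ℝ} {u : Ω → Fin m → ℝ}

theorem integral_affine (hx : MemLp x 2 μ) (hu : MemLp u 2 μ)
    (A A' : Matrix (Fin n) (Fin n) ℝ) (B B' : Matrix (Fin n) (Fin m) ℝ) (b : Fin n → ℝ) :
    ∫ ω, (A *ᵥ x ω + A' *ᵥ (∫ ω', x ω' ∂μ) + B *ᵥ u ω + B' *ᵥ (∫ ω', u ω' ∂μ) + b) ∂μ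
      = (A + A') *ᵥ (∫ ω', x ω' ∂μ) + (B + B') *ᵥ (∫ ω', u ω' ∂μ) + b := by
  have i1 := (memLp_mulVec A hx).integrable (by norm_num : (1 : ENNReal) ≤ 2)
  have i2 := (memLp_mulVec B hu).integrable (by norm_num : (1 : ENNReal) ≤ 2)
  have e : ∀ ω, A *ᵥ x ω + A' *ᵥ (∫ ω', x ω' ∂μ) + B *ᵥ u ω + B' *ᵥ (∫ ω', u ω' ∂μ) + b
      = ((fun ω => A *ᵥ x ω) + fun ω => B *ᵥ u ω) ω
        + (A' *ᵥ (∫ ω', x ω' ∂μ) + B' *ᵥ (∫ ω', u ω' ∂μ) + b) := fun ω => by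
    simp only [Pi.add_apply]; abel
  simp only [e]
  rw [integral_add (i1.add i2) (integrable_const _), integral_add' i1 i2, integral_mulVec A hx,
    integral_mulVec B hu]
  simp only [integral_const, probReal_univ, one_smul, Matrix.add_mulVec]
  abel

variable (hξ : Measurable ξ) (hw : IsNoise μ w l M.N ξ) (hk : k ∈ Finset.Ico l M.N)
  (hx : IsL2 μ (past w l ξ k) x) (hu : IsL2 μ (past w l ξ k) u)

include hξ hw hk hx hu

theorem isL2_step : IsL2 μ (past w l ξ (k + 1)) (M.step μ w k x u) := by
  have hk' := Finset.mem_Ico.1 hk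
  obtain ⟨hwm, hw0, -, hw2⟩ := hw k hk
  have ha := hx.affine hu (M.A k) (M.Abar k) (M.B k) (M.Bbar k) (∫ ω', x ω' ∂μ)
    (∫ ω', u ω' ∂μ) (M.b k)
  have hc := hx.affine hu (M.C k) (M.Cbar k) (M.D k) (M.Dbar k) (∫ ω', x ω' ∂μ)
    (∫ ω', u ω' ∂μ) (M.σ k)
  have hle : past w l ξ k ≤ past w l ξ (k + 1) := past_mono (Nat.le_succ k)
  refine (ha.mono hle).add ⟨?_, hc.memLp_noise_smul (past_le hξ hw hk'.2.le) hwm hw0 hw2⟩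
  exact (measurable_past_noise (Finset.mem_Ico.2 ⟨hk'.1, k.lt_succ_self⟩)).smul (hc.mono hle).meas

theorem integral_step : ∫ ω, M.step μ w k x u ω ∂μ
    = (M.A k + M.Abar k) *ᵥ (∫ ω, x ω ∂μ) + (M.B k + M.Bbar k) *ᵥ (∫ ω, u ω ∂μ) + M.b k := by
  have hk' := Finset.mem_Ico.1 hk
  obtain ⟨hwm, hw0, hw1, hw2⟩ := hw k hk
  have ha := hx.affine hu (M.A k) (M.Abar k) (M.B k) (M.Bbar k) (∫ ω', x ω' ∂μ)
    (∫ ω', u ω' ∂μ) (M.b k)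
  have hc := hx.affine hu (M.C k) (M.Cbar k) (M.D k) (M.Dbar k) (∫ ω', x ω' ∂μ)
    (∫ ω', u ω' ∂μ) (M.σ k)
  have hle := past_le hξ hw hk'.2.le
  simp only [step]
  rw [integral_add (ha.memLp.integrable (by norm_num))
    ((hc.memLp_noise_smul hle hwm hw0 hw2).integrable (by norm_num)),
    hc.integral_noise_smul hle hwm hw0 hw1 hw2, integral_affine hx.memLp hu.memLp, add_zero]

/-- Subtracting the mean removes the mean-field and constant terms from the drift, but not from the
diffusion, whose contribution has mean zero already. -/
theorem centered_step (ω : Ω) : centered μ (M.step μ w k x u) ω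
    = (M.A k *ᵥ centered μ x ω + M.B k *ᵥ centered μ u ω)
      + w k ω • ((M.C k *ᵥ centered μ x ω + M.D k *ᵥ centered μ u ω)
        + ((M.C k + M.Cbar k) *ᵥ (∫ ω, x ω ∂μ) + (M.D k + M.Dbar k) *ᵥ (∫ ω, u ω ∂μ)
          + M.σ k)) := by
  rw [centered, M.integral_step hξ hw hk hx hu]
  simp only [step, centered, Matrix.mulVec_sub, Matrix.add_mulVec]
  module

/-- The noise kills the cross terms between drift and diffusion; the diffusion coefficient then
splits into its deviation and its mean. The mean part is why $P$ also enters the equation for $\Pi$.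
-/
theorem integral_quad_step (P : Matrix (Fin n) (Fin n) ℝ) :
    ∫ ω, (P *ᵥ centered μ (M.step μ w k x u) ω) ⬝ᵥ centered μ (M.step μ w k x u) ω ∂μ
      = ∫ ω, (P *ᵥ (M.A k *ᵥ centered μ x ω + M.B k *ᵥ centered μ u ω)) ⬝ᵥ
          (M.A k *ᵥ centered μ x ω + M.B k *ᵥ centered μ u ω) ∂μ
        + ∫ ω, (P *ᵥ (M.C k *ᵥ centered μ x ω + M.D k *ᵥ centered μ u ω)) ⬝ᵥ
          (M.C k *ᵥ centered μ x ω + M.D k *ᵥ centered μ u ω) ∂μ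
        + (P *ᵥ ((M.C k + M.Cbar k) *ᵥ (∫ ω, x ω ∂μ) + (M.D k + M.Dbar k) *ᵥ (∫ ω, u ω ∂μ)
            + M.σ k)) ⬝ᵥ ((M.C k + M.Cbar k) *ᵥ (∫ ω, x ω ∂μ)
              + (M.D k + M.Dbar k) *ᵥ (∫ ω, u ω ∂μ) + M.σ k) := by
  have hk' := Finset.mem_Ico.1 hk
  obtain ⟨hwm, hw0, hw1, hw2⟩ := hw k hk
  have hle := past_le hξ hw hk'.2.le
  set c := (M.C k + M.Cbar k) *ᵥ (∫ ω, x ω ∂μ) + (M.D k + M.Dbar k) *ᵥ (∫ ω, u ω ∂μ)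
    + M.σ k with hc
  have ha := (hx.centered.mulVec (M.A k)).add (hu.centered.mulVec (M.B k))
  have hd := (hx.centered.mulVec (M.C k)).add (hu.centered.mulVec (M.D k))
  have hdc := hd.add (.const c)
  have h0 : ∫ ω, (M.C k *ᵥ centered μ x ω + M.D k *ᵥ centered μ u ω) ∂μ = 0 := by
    rw [integral_add (((hx.centered.mulVec (M.C k)).memLp).integrable (by norm_num))
      (((hu.centered.mulVec (M.D k)).memLp).integrable (by norm_num)),
      integral_mulVec _ hx.centered.memLp, integral_mulVec _ hu.centered.memLp,
      integral_centered hx.memLp, integral_centered hu.memLp]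
    simp
  have h1 : ∫ ω, ((M.C k *ᵥ centered μ x ω + M.D k *ᵥ centered μ u ω) + c) ∂μ = c := by
    rw [integral_add (hd.memLp.integrable (by norm_num)) (integrable_const _), h0]; simp
  have h2 : ∀ ω, centered μ (fun ω => (M.C k *ᵥ centered μ x ω + M.D k *ᵥ centered μ u ω) + c) ω
      = M.C k *ᵥ centered μ x ω + M.D k *ᵥ centered μ u ω := fun ω => by
    rw [centered, h1, add_sub_cancel_right]
  simp only [M.centered_step hξ hw hk hx hu, ← hc]
  rw [IsL2.integral_quad_add_noise hle hwm hw0 hw1 hw2 P ha hdc,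
    integral_quad_eq P hdc.memLp hdc.memLp, h1]
  simp only [h2]
  ring

end Step

end Problem

end MFLQ

/-! ### The dynamic programming identity. -/

namespace MFLQ.Problem

variable {Ω : Type*} {n m : ℕ} (M : Problem Ω n m)

/-- The quadratic part of the stage cost, at the deviations from the mean. -/
theorem centeredStage_eq {ε : ℝ} {k : ℕ} (hk : k < M.N) (X : Fin n → ℝ) (U : Fin m → ℝ)
    (h : IsUnit (M.upsilon ε k).det ∨ X = 0 ∧ U = 0) :
    let X' := M.A k *ᵥ X + M.B k *ᵥ U
    let Y' := M.C k *ᵥ X + M.D k *ᵥ U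
    let d := U - M.theta ε k *ᵥ X
    (M.ricP ε (k + 1) *ᵥ X') ⬝ᵥ X' + (M.ricP ε (k + 1) *ᵥ Y') ⬝ᵥ Y'
        + ((M.Q k *ᵥ X) ⬝ᵥ X + 2 * ((M.S k *ᵥ X) ⬝ᵥ U) + ((M.R k + ε • 1) *ᵥ U) ⬝ᵥ U)
      = (M.ricP ε k *ᵥ X) ⬝ᵥ X + (M.upsilon ε k *ᵥ d) ⬝ᵥ d := by
  intro X' Y' d
  rcases h with hU | ⟨rfl, rfl⟩
  · have hP := (M.riccati_symm ε (Nat.succ_le_of_lt hk)).1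
    -- For the deviations, $P$ weights both drift and diffusion, and all affine terms are absent.
    have h1 := step_expand hP hP (Q := M.Q k) (M.A k) (M.C k) (M.B k) (M.D k) (M.S k)
      (M.R k + ε • 1) 0 0 0 0 0 X U
    have h2 := complete_square (M.upsilon_symm ε hk) hU (M.hOf k (M.ricP ε (k + 1))) 0 X U
    simp only [Matrix.mulVec_zero, add_zero, zero_dotProduct, mul_zero, neg_zero, sub_zero] at h1 h2
    rw [h1]
    change _ + (((M.upsilon ε k) *ᵥ U) ⬝ᵥ U + 2 * (M.hOf k (M.ricP ε (k + 1)) *ᵥ X) ⬝ᵥ U) = _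
    rw [h2, M.ricP_eq ε hk]
    change _ + (M.upsilon ε k *ᵥ d ⬝ᵥ d - _) = _
    simp only [Matrix.sub_mulVec, sub_dotProduct]
    ring
  · simp [X', Y', d]

variable [m0 : MeasurableSpace Ω] (μ : Measure Ω)

/-- The expected running cost at time `k`, the linear weights entering through their means. -/
noncomputable def runningCost (ε : ℝ) (k : ℕ) (x : Ω → Fin n → ℝ) (u : Ω → Fin m → ℝ) : ℝ :=
  ∫ ω, (M.Q k *ᵥ x ω) ⬝ᵥ x ω ∂μ + 2 * ∫ ω, (M.S k *ᵥ x ω) ⬝ᵥ u ω ∂μ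
    + ∫ ω, ((M.R k + ε • 1) *ᵥ u ω) ⬝ᵥ u ω ∂μ
    + ((M.Qbar k *ᵥ ∫ ω, x ω ∂μ) ⬝ᵥ (∫ ω, x ω ∂μ)
      + 2 * ((M.Sbar k *ᵥ ∫ ω, x ω ∂μ) ⬝ᵥ ∫ ω, u ω ∂μ)
      + (M.Rbar k *ᵥ ∫ ω, u ω ∂μ) ⬝ᵥ ∫ ω, u ω ∂μ)
    + 2 * ((∫ ω, M.q k ω ∂μ + ∫ ω, M.qbar k ω ∂μ) ⬝ᵥ ∫ ω, x ω ∂μ)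
    + 2 * ((∫ ω, M.ρ k ω ∂μ + ∫ ω, M.ρbar k ω ∂μ) ⬝ᵥ ∫ ω, u ω ∂μ)

/-- The quadratic value function of the regularized problem at time `k`, up to a constant. -/
noncomputable def stageValue (ε : ℝ) (k : ℕ) (x : Ω → Fin n → ℝ) : ℝ :=
  ∫ ω, (M.ricP ε k *ᵥ centered μ x ω) ⬝ᵥ centered μ x ω ∂μ
    + (M.ricPi ε k *ᵥ ∫ ω, x ω ∂μ) ⬝ᵥ (∫ ω, x ω ∂μ) + 2 * (M.eta μ ε k ⬝ᵥ ∫ ω, x ω ∂μ)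

/-- The linear weight of the mean of the control at time `k`. -/
noncomputable def zeta (ε : ℝ) (k : ℕ) : Fin m → ℝ := M.zetaOf μ ε k (M.eta μ ε (k + 1))

/-- The loss at time `k` caused by the deviation of the control from the feedback law. -/
noncomputable def gap (ε : ℝ) (k : ℕ) (x : Ω → Fin n → ℝ) (u : Ω → Fin m → ℝ) : ℝ :=
  ∫ ω, (M.upsilon ε k *ᵥ (centered μ u ω - M.theta ε k *ᵥ centered μ x ω)) ⬝ᵥ
      (centered μ u ω - M.theta ε k *ᵥ centered μ x ω) ∂μ
    + (M.upsilonBar ε k *ᵥ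
        (∫ ω, u ω ∂μ - M.thetaBar ε k *ᵥ (∫ ω, x ω ∂μ) - M.vOffset μ ε k)) ⬝ᵥ
      (∫ ω, u ω ∂μ - M.thetaBar ε k *ᵥ (∫ ω, x ω ∂μ) - M.vOffset μ ε k)

/-- The part of the stage cost that depends neither on the state nor on the control. -/
noncomputable def stageConst (ε : ℝ) (k : ℕ) : ℝ :=
  (M.ricPi ε (k + 1) *ᵥ M.b k) ⬝ᵥ M.b k + 2 * (M.eta μ ε (k + 1) ⬝ᵥ M.b k)
    + (M.ricP ε (k + 1) *ᵥ M.σ k) ⬝ᵥ M.σ k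

theorem eta_eq (ε : ℝ) {k : ℕ} (hk : k < M.N) :
    M.eta μ ε k = (M.C k + M.Cbar k)ᵀ *ᵥ (M.ricP ε (k + 1) *ᵥ M.σ k)
      + (M.A k + M.Abar k)ᵀ *ᵥ (M.ricPi ε (k + 1) *ᵥ M.b k + M.eta μ ε (k + 1))
      + ∫ ω, M.q k ω ∂μ + ∫ ω, M.qbar k ω ∂μ + (M.thetaBar ε k)ᵀ *ᵥ M.zeta μ ε k := by
  rw [eta, backward_step _ _ _ hk]; rfl

/-- The stage cost at the mean. -/
theorem meanStage_eq {ε : ℝ} {k : ℕ} (hk : k < M.N) (hUbar : IsUnit (M.upsilonBar ε k).det)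
    (X : Fin n → ℝ) (U : Fin m → ℝ) :
    let X' := (M.A k + M.Abar k) *ᵥ X + (M.B k + M.Bbar k) *ᵥ U + M.b k
    let Y' := (M.C k + M.Cbar k) *ᵥ X + (M.D k + M.Dbar k) *ᵥ U + M.σ k
    let d := U - M.thetaBar ε k *ᵥ X - M.vOffset μ ε k
    (M.ricPi ε (k + 1) *ᵥ X') ⬝ᵥ X' + 2 * (M.eta μ ε (k + 1) ⬝ᵥ X')
        + (M.ricP ε (k + 1) *ᵥ Y') ⬝ᵥ Y'
        + (((M.Q k + M.Qbar k) *ᵥ X) ⬝ᵥ X + 2 * (((M.S k + M.Sbar k) *ᵥ X) ⬝ᵥ U)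
          + ((M.R k + M.Rbar k + ε • 1) *ᵥ U) ⬝ᵥ U
          + 2 * ((∫ ω, M.q k ω ∂μ + ∫ ω, M.qbar k ω ∂μ) ⬝ᵥ X)
          + 2 * ((∫ ω, M.ρ k ω ∂μ + ∫ ω, M.ρbar k ω ∂μ) ⬝ᵥ U))
      = (M.ricPi ε k *ᵥ X) ⬝ᵥ X + 2 * (M.eta μ ε k ⬝ᵥ X) + (M.upsilonBar ε k *ᵥ d) ⬝ᵥ d
        + (M.stageConst μ ε k + M.zeta μ ε k ⬝ᵥ M.vOffset μ ε k) := by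
  intro X' Y' d
  -- For the means, $\Pi$ weights the drift, and $P$ weights the mean of the diffusion coefficient.
  have h1 := step_expand (M.riccati_symm ε (Nat.succ_le_of_lt hk)).2
    (M.riccati_symm ε (Nat.succ_le_of_lt hk)).1 (Q := M.Q k + M.Qbar k) (M.A k + M.Abar k)
    (M.C k + M.Cbar k) (M.B k + M.Bbar k) (M.D k + M.Dbar k) (M.S k + M.Sbar k)
    (M.R k + M.Rbar k + ε • 1) (M.b k) (M.σ k) (M.eta μ ε (k + 1))
    (∫ ω, M.q k ω ∂μ + ∫ ω, M.qbar k ω ∂μ) (∫ ω, M.ρ k ω ∂μ + ∫ ω, M.ρbar k ω ∂μ) X U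
  have h2 := complete_square (M.upsilonBar_symm ε hk) hUbar
    (M.hBarOf k (M.ricP ε (k + 1)) (M.ricPi ε (k + 1))) (M.zeta μ ε k) X U
  have e1 : M.zeta μ ε k = (M.D k + M.Dbar k)ᵀ *ᵥ (M.ricP ε (k + 1) *ᵥ M.σ k)
      + (M.B k + M.Bbar k)ᵀ *ᵥ (M.ricPi ε (k + 1) *ᵥ M.b k + M.eta μ ε (k + 1))
      + (∫ ω, M.ρ k ω ∂μ + ∫ ω, M.ρbar k ω ∂μ) := by
    simp only [zeta, zetaOf]; abel
  have e2 : M.hBarOf k (M.ricP ε (k + 1)) (M.ricPi ε (k + 1))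
      = (M.B k + M.Bbar k)ᵀ * M.ricPi ε (k + 1) * (M.A k + M.Abar k)
        + (M.D k + M.Dbar k)ᵀ * M.ricP ε (k + 1) * (M.C k + M.Cbar k) + (M.S k + M.Sbar k) := by
    simp only [hBarOf]; abel
  rw [h1, ← e1, ← e2]
  change _ + (((M.upsilonBar ε k) *ᵥ U) ⬝ᵥ U + _ + _) + _ = _
  rw [h2, M.ricPi_eq ε hk, M.eta_eq μ ε hk, stageConst]
  change _ + (M.upsilonBar ε k *ᵥ d ⬝ᵥ d - _ + 2 * ((M.thetaBar ε k)ᵀ *ᵥ _ ⬝ᵥ _)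
    + _ ⬝ᵥ M.vOffset μ ε k) + _ = _
  simp only [Matrix.sub_mulVec, sub_dotProduct, add_dotProduct]
  ring

variable {μ} [IsProbabilityMeasure μ] {w : ℕ → Ω → ℝ} {l : ℕ} {ξ : Ω → Fin n → ℝ} {k : ℕ}
  {x : Ω → Fin n → ℝ} {u : Ω → Fin m → ℝ}

theorem runningCost_eq (hx : MemLp x 2 μ) (hu : MemLp u 2 μ) (ε : ℝ) :
    M.runningCost μ ε k x u
      = ∫ ω, ((M.Q k *ᵥ centered μ x ω) ⬝ᵥ centered μ x ω
          + 2 * ((M.S k *ᵥ centered μ x ω) ⬝ᵥ centered μ u ω)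
          + ((M.R k + ε • 1) *ᵥ centered μ u ω) ⬝ᵥ centered μ u ω) ∂μ
        + (((M.Q k + M.Qbar k) *ᵥ ∫ ω, x ω ∂μ) ⬝ᵥ (∫ ω, x ω ∂μ)
          + 2 * (((M.S k + M.Sbar k) *ᵥ ∫ ω, x ω ∂μ) ⬝ᵥ ∫ ω, u ω ∂μ)
          + ((M.R k + M.Rbar k + ε • 1) *ᵥ ∫ ω, u ω ∂μ) ⬝ᵥ (∫ ω, u ω ∂μ)
          + 2 * ((∫ ω, M.q k ω ∂μ + ∫ ω, M.qbar k ω ∂μ) ⬝ᵥ ∫ ω, x ω ∂μ)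
          + 2 * ((∫ ω, M.ρ k ω ∂μ + ∫ ω, M.ρbar k ω ∂μ) ⬝ᵥ ∫ ω, u ω ∂μ)) := by
  have hxc := memLp_centered hx
  have huc := memLp_centered hu
  rw [runningCost, integral_quad_eq _ hx hx, integral_quad_eq _ hx hu, integral_quad_eq _ hu hu,
    (((HasMean.quad (M.Q k) hxc hxc).add ((HasMean.quad (M.S k) hxc huc).const_mul 2)).add
      (HasMean.quad (M.R k + ε • 1) huc huc)).2]
  simp only [Matrix.add_mulVec, add_dotProduct]
  ring

variable (hξ : Measurable ξ) (hw : IsNoise μ w l M.N ξ) (hk : k ∈ Finset.Ico l M.N)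
  (hx : IsL2 μ (past w l ξ k) x) (hu : IsL2 μ (past w l ξ k) u)

include hξ hw hk hx hu

/-- The dynamic programming identity. -/
theorem stageValue_step {ε : ℝ} (hUbar : IsUnit (M.upsilonBar ε k).det)
    (hU : IsUnit (M.upsilon ε k).det ∨ centered μ x =ᵐ[μ] 0 ∧ centered μ u =ᵐ[μ] 0) :
    M.stageValue μ ε (k + 1) (M.step μ w k x u) + M.runningCost μ ε k x u
      = M.stageValue μ ε k x + M.gap μ ε k x u
        + (M.stageConst μ ε k + M.zeta μ ε k ⬝ᵥ M.vOffset μ ε k) := by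
  have hkN := (Finset.mem_Ico.1 hk).2
  have hxc := hx.centered
  have huc := hu.centered
  have hX' := ((hxc.mulVec (M.A k)).add (huc.mulVec (M.B k))).memLp
  have hY' := ((hxc.mulVec (M.C k)).add (huc.mulVec (M.D k))).memLp
  have hd := (huc.sub (hxc.mulVec (M.theta ε k))).memLp
  have h1 := M.meanStage_eq μ hkN hUbar (∫ ω, x ω ∂μ) (∫ ω, u ω ∂μ)
  have hL := ((HasMean.quad (M.ricP ε (k + 1)) hX' hX').add
    (HasMean.quad (M.ricP ε (k + 1)) hY' hY')).add (((HasMean.quad (M.Q k) hxc.memLp hxc.memLp).add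
      ((HasMean.quad (M.S k) hxc.memLp huc.memLp).const_mul 2)).add
      (HasMean.quad (M.R k + ε • 1) huc.memLp huc.memLp))
  have hR := (HasMean.quad (M.ricP ε k) hxc.memLp hxc.memLp).add
    (HasMean.quad (M.upsilon ε k) hd hd)
  have h2 := integral_congr_ae (μ := μ) (f := fun ω =>
    (M.ricP ε (k + 1) *ᵥ (M.A k *ᵥ centered μ x ω + M.B k *ᵥ centered μ u ω)) ⬝ᵥ
        (M.A k *ᵥ centered μ x ω + M.B k *ᵥ centered μ u ω)
      + (M.ricP ε (k + 1) *ᵥ (M.C k *ᵥ centered μ x ω + M.D k *ᵥ centered μ u ω)) ⬝ᵥ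
        (M.C k *ᵥ centered μ x ω + M.D k *ᵥ centered μ u ω)
      + ((M.Q k *ᵥ centered μ x ω) ⬝ᵥ centered μ x ω
        + 2 * ((M.S k *ᵥ centered μ x ω) ⬝ᵥ centered μ u ω)
        + ((M.R k + ε • 1) *ᵥ centered μ u ω) ⬝ᵥ centered μ u ω))
    (g := fun ω => (M.ricP ε k *ᵥ centered μ x ω) ⬝ᵥ centered μ x ω
      + (M.upsilon ε k *ᵥ (centered μ u ω - M.theta ε k *ᵥ centered μ x ω)) ⬝ᵥ
        (centered μ u ω - M.theta ε k *ᵥ centered μ x ω)) <| by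
    -- If the deviations vanish a.e., both sides are zero and no inverse is needed.
    rcases hU with hU | ⟨h, h'⟩
    · exact Eventually.of_forall fun ω => M.centeredStage_eq hkN _ _ (.inl hU)
    · filter_upwards [h, h'] with ω h h'
      exact M.centeredStage_eq hkN _ _ (.inr ⟨h, h'⟩)
  rw [hL.2, hR.2] at h2
  rw [stageValue, M.integral_quad_step hξ hw hk hx hu, M.integral_step hξ hw hk hx hu,
    M.runningCost_eq hx.memLp hu.memLp, stageValue, gap,
    (((HasMean.quad (M.Q k) hxc.memLp hxc.memLp).add
      ((HasMean.quad (M.S k) hxc.memLp huc.memLp).const_mul 2)).add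
      (HasMean.quad (M.R k + ε • 1) huc.memLp huc.memLp)).2]
  linarith

end MFLQ.Problem

/-! ### Trajectories, the feedback law, and the cost as a telescoping sum. -/

namespace MFLQ.Problem

variable {Ω : Type*} {n m : ℕ} (M : Problem Ω n m) [m0 : MeasurableSpace Ω] {μ : Measure Ω}
  {w : ℕ → Ω → ℝ} {l : ℕ} {ξ x₀ : Ω → Fin n → ℝ}

section Trajectory

variable {policy : ℕ → (Ω → Fin n → ℝ) → (Ω → Fin m → ℝ)}

theorem trajectory_of_le {k : ℕ} (hk : k ≤ l) : M.trajectory μ w l x₀ policy k = x₀ := by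
  cases k with
  | zero => rfl
  | succ k => rw [trajectory, if_pos (Nat.lt_of_succ_le hk)]

theorem trajectory_succ {k : ℕ} (hk : l ≤ k) : M.trajectory μ w l x₀ policy (k + 1)
    = M.step μ w k (M.trajectory μ w l x₀ policy k)
        (policy k (M.trajectory μ w l x₀ policy k)) := by
  rw [trajectory, if_neg (not_lt.2 hk)]

theorem state_succ {u : ℕ → Ω → Fin m → ℝ} {k : ℕ} (hk : l ≤ k) : M.state μ w l x₀ u (k + 1)
    = M.step μ w k (M.state μ w l x₀ u k) (u k) :=
  M.trajectory_succ hk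

/-- A feedback evaluated along its own closed loop, read as an open-loop control, regenerates the
same state. This lets feedbacks compete with arbitrary admissible controls. -/
theorem state_policy : M.state μ w l x₀ (fun k => policy k (M.trajectory μ w l x₀ policy k))
    = M.trajectory μ w l x₀ policy := by
  funext k
  induction k with
  | zero => rfl
  | succ k ih =>
    rcases lt_or_ge k l with h | h
    · rw [state, M.trajectory_of_le h, M.trajectory_of_le h]
    · rw [M.state_succ h, ih, M.trajectory_succ h]

variable [IsProbabilityMeasure μ] (hξ : Measurable ξ) (hw : IsNoise μ w l M.N ξ)
  (hx₀ : IsL2 μ (past w l ξ l) x₀)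

include hξ hw hx₀

theorem isL2_trajectory (hpol : ∀ k ∈ Finset.Ico l M.N, ∀ x, IsL2 μ (past w l ξ k) x →
      IsL2 μ (past w l ξ k) (policy k x)) {k : ℕ} (hlk : l ≤ k) (hk : k ≤ M.N) :
    IsL2 μ (past w l ξ k) (M.trajectory μ w l x₀ policy k) := by
  induction k, hlk using Nat.le_induction with
  | base => rwa [M.trajectory_of_le le_rfl]
  | succ k hlk ih =>
    have hk' : k ∈ Finset.Ico l M.N := Finset.mem_Ico.2 ⟨hlk, hk⟩
    have h := ih (Nat.le_of_succ_le hk)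
    rw [M.trajectory_succ hlk]
    exact M.isL2_step hξ hw hk' h (hpol k hk' _ h)

theorem isL2_state {u : ℕ → Ω → Fin m → ℝ} (hu : u ∈ Admissible μ w l M.N ξ) {k : ℕ}
    (hlk : l ≤ k) (hk : k ≤ M.N) : IsL2 μ (past w l ξ k) (M.state μ w l x₀ u k) :=
  M.isL2_trajectory hξ hw hx₀ (fun k hk _ _ => ⟨(hu k hk).1, (hu k hk).2⟩) hlk hk

theorem admissible_policy (hpol : ∀ k ∈ Finset.Ico l M.N, ∀ x, IsL2 μ (past w l ξ k) x →
      IsL2 μ (past w l ξ k) (policy k x)) :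
    (fun k => policy k (M.trajectory μ w l x₀ policy k)) ∈ Admissible μ w l M.N ξ := by
  intro k hk
  have hk' := Finset.mem_Ico.1 hk
  have h := hpol k hk _ (M.isL2_trajectory hξ hw hx₀ hpol hk'.1 hk'.2.le)
  exact ⟨h.meas, h.memLp⟩

end Trajectory

section Feedback

theorem gap_nonneg {ε : ℝ} {k : ℕ} {x : Ω → Fin n → ℝ} {u : Ω → Fin m → ℝ}
    (hUbar : (M.upsilonBar ε k).PosSemidef)
    (hU : (M.upsilon ε k).PosSemidef ∨ centered μ x =ᵐ[μ] 0 ∧ centered μ u =ᵐ[μ] 0) :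
    0 ≤ M.gap μ ε k x u := by
  refine add_nonneg (integral_nonneg_of_ae ?_) (quad_nonneg hUbar _)
  rcases hU with h | ⟨h, h'⟩
  · exact Eventually.of_forall fun ω => quad_nonneg h _
  · filter_upwards [h, h'] with ω h h'
    simp [h, h']

variable [IsProbabilityMeasure μ]

theorem isL2_feedbackLaw (ε : ℝ) (k : ℕ) {x : Ω → Fin n → ℝ} (hx : IsL2 μ (past w l ξ k) x) :
    IsL2 μ (past w l ξ k) (M.feedbackLaw μ ε k x) :=
  ((hx.centered.mulVec _).add (.const _)).add (.const _)

/-- The gain `theta` acts on a centered vector, so the mean of the law is its remaining part; both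
squares then vanish, whatever the weights. -/
theorem gap_feedbackLaw (ε : ℝ) (k : ℕ) {x : Ω → Fin n → ℝ} (hx : MemLp x 2 μ) :
    M.gap μ ε k x (M.feedbackLaw μ ε k x) = 0 := by
  have h1 : ∫ ω, M.feedbackLaw μ ε k x ω ∂μ
      = M.thetaBar ε k *ᵥ (∫ ω, x ω ∂μ) + M.vOffset μ ε k := by
    have e : ∀ ω, M.feedbackLaw μ ε k x ω = M.theta ε k *ᵥ centered μ x ω
        + (M.thetaBar ε k *ᵥ (∫ ω, x ω ∂μ) + M.vOffset μ ε k) := fun ω => by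
      simp only [feedbackLaw, centered]; abel
    simp only [e]
    rw [integral_add ((memLp_mulVec _ (memLp_centered hx)).integrable (by norm_num))
      (integrable_const _), integral_mulVec _ (memLp_centered hx), integral_centered hx]
    simp
  have h2 : ∀ ω, centered μ (M.feedbackLaw μ ε k x) ω - M.theta ε k *ᵥ centered μ x ω = 0 :=
    fun ω => by
      rw [centered, h1]; simp only [feedbackLaw, centered]; abel
  simp only [gap, h2, h1, add_sub_cancel_left, sub_self]
  simp

end Feedback

section Cost

theorem hasMean_control_sq {u : ℕ → Ω → Fin m → ℝ} (hu : u ∈ Admissible μ w l M.N ξ) :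
    HasMean μ (fun ω => ∑ k ∈ Finset.Ico l M.N, u k ω ⬝ᵥ u k ω)
    (∑ k ∈ Finset.Ico l M.N, ∫ ω, u k ω ⬝ᵥ u k ω ∂μ) :=
  HasMean.sum fun k hk => HasMean.of_integrable (integrable_dotProduct (hu k hk).2 (hu k hk).2)

variable [IsProbabilityMeasure μ] (hξ : Measurable ξ) (hw : IsNoise μ w l M.N ξ)
  (hx₀ : IsL2 μ (past w l ξ l) x₀) {u : ℕ → Ω → Fin m → ℝ} (hu : u ∈ Admissible μ w l M.N ξ)

include hξ hw hx₀ hu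

/-- The regularized cost is the sum of the terminal cost and the running costs. -/
theorem costReg_eq (hM : M.SquareIntegrable μ) (hdet : M.DeterministicWeights μ) (hl : l ≤ M.N)
    (ε : ℝ) : M.costReg μ w l x₀ ε u = M.stageValue μ ε M.N (M.state μ w l x₀ u M.N)
      + ∑ k ∈ Finset.Ico l M.N, M.runningCost μ ε k (M.state μ w l x₀ u k) (u k) := by
  obtain ⟨hg, hgbar, hwt⟩ := hM
  obtain ⟨hgc, hwc⟩ := hdet
  set x := M.state μ w l x₀ u with hx
  have hxN : MemLp (x M.N) 2 μ := (M.isL2_state hξ hw hx₀ hu hl le_rfl).memLp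
  have hT := (((HasMean.quad M.G hxN hxN).add
    ((HasMean.dotProduct_of_const hg hgc hxN).const_mul 2)).add
    (HasMean.const ((M.Gbar *ᵥ ∫ ω, x M.N ω ∂μ) ⬝ᵥ ∫ ω, x M.N ω ∂μ))).add
    ((HasMean.dotProduct_const hgbar (∫ ω, x M.N ω ∂μ)).const_mul 2)
  have hxk : ∀ k ∈ Finset.Ico l M.N, MemLp (x k) 2 μ := fun k hk =>
    (M.isL2_state hξ hw hx₀ hu (Finset.mem_Ico.1 hk).1 (Finset.mem_Ico.1 hk).2.le).memLp
  have h1 := HasMean.sum (s := Finset.Ico l M.N) fun k hk =>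
    let hxk := hxk k hk
    let huk := (hu k hk).2
    let hk' := (Finset.mem_Ico.1 hk).2
    (((HasMean.quad (M.Q k) hxk hxk).add ((HasMean.quad (M.S k) hxk huk).const_mul 2)).add
      (HasMean.quad (M.R k) huk huk)).add
      (((HasMean.dotProduct_of_const (hwt k hk').1 (hwc k hk').1 hxk).add
        (HasMean.dotProduct_of_const (hwt k hk').2.2.1 (hwc k hk').2 huk)).const_mul 2)
  have h2 := HasMean.sum (s := Finset.Ico l M.N) fun k hk =>
    let hk' := (Finset.mem_Ico.1 hk).2
    (HasMean.const (μ := μ) ((M.Qbar k *ᵥ ∫ ω, x k ω ∂μ) ⬝ᵥ (∫ ω, x k ω ∂μ)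
        + 2 * ((M.Sbar k *ᵥ ∫ ω, x k ω ∂μ) ⬝ᵥ ∫ ω, u k ω ∂μ)
        + (M.Rbar k *ᵥ ∫ ω, u k ω ∂μ) ⬝ᵥ ∫ ω, u k ω ∂μ)).add
      (((HasMean.dotProduct_const (hwt k hk').2.1 (∫ ω, x k ω ∂μ)).add
        (HasMean.dotProduct_const (hwt k hk').2.2.2 (∫ ω, u k ω ∂μ))).const_mul 2)
  have hcost : M.cost μ w l x₀ u = _ := ((hT.add h1).add h2).2
  rw [costReg, (M.hasMean_control_sq hu).2, Finset.mul_sum]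
  rw [hcost, add_assoc, add_assoc, ← Finset.sum_add_distrib, ← Finset.sum_add_distrib]
  congr 1
  -- The terminal data $G$, $G+\bar G$, $\mathbb E(g+\bar g)$ make `stageValue` at time `M.N` the
  -- terminal cost.
  · rw [stageValue, integral_quad_eq _ hxN hxN]
    simp only [ricP, ricPi, riccati, eta, backward_terminal, Matrix.add_mulVec, add_dotProduct]
    ring
  · refine Finset.sum_congr rfl fun k hk => ?_
    have hq := (((HasMean.quad (M.R k) (hu k hk).2 (hu k hk).2).add
      ((HasMean.of_integrable (integrable_dotProduct (hu k hk).2 (hu k hk).2)).const_mul ε)).2)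
    have e : ∀ ω, ((M.R k + ε • 1) *ᵥ u k ω) ⬝ᵥ u k ω
        = (M.R k *ᵥ u k ω) ⬝ᵥ u k ω + ε * (u k ω ⬝ᵥ u k ω) := fun ω => by
      rw [Matrix.add_mulVec, Matrix.smul_mulVec, Matrix.one_mulVec, add_dotProduct,
        smul_dotProduct, smul_eq_mul]
    simp only [runningCost, e]
    rw [hq]
    simp only [add_dotProduct]
    ring

omit hu in
/-- Telescoping of the dynamic programming identity. -/
theorem stageValue_add_sum {ε : ℝ} (hu : u ∈ Admissible μ w l M.N ξ) {j : ℕ} (hlj : l ≤ j)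
    (hj : j ≤ M.N)
    (hUbar : ∀ k ∈ Finset.Ico j M.N, IsUnit (M.upsilonBar ε k).det)
    (hU : ∀ k ∈ Finset.Ico j M.N, IsUnit (M.upsilon ε k).det ∨
      centered μ (M.state μ w l x₀ u k) =ᵐ[μ] 0 ∧ centered μ (u k) =ᵐ[μ] 0) :
    M.stageValue μ ε M.N (M.state μ w l x₀ u M.N)
        + ∑ k ∈ Finset.Ico j M.N, M.runningCost μ ε k (M.state μ w l x₀ u k) (u k)
      = M.stageValue μ ε j (M.state μ w l x₀ u j)
        + ∑ k ∈ Finset.Ico j M.N, (M.gap μ ε k (M.state μ w l x₀ u k) (u k)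
          + (M.stageConst μ ε k + M.zeta μ ε k ⬝ᵥ M.vOffset μ ε k)) := by
  induction hj using Nat.decreasingInduction with
  | self => simp
  | of_succ j hj ih =>
    have hsub : Finset.Ico (j + 1) M.N ⊆ Finset.Ico j M.N :=
      Finset.Ico_subset_Ico_left (Nat.le_succ j)
    have hjmem := Finset.left_mem_Ico.2 hj
    have hjl : j ∈ Finset.Ico l M.N := Finset.mem_Ico.2 ⟨hlj, hj⟩
    have h1 := ih (hlj.trans (Nat.le_succ j)) (fun k hk => hUbar k (hsub hk))
      (fun k hk => hU k (hsub hk))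
    have h2 := M.stageValue_step hξ hw hjl (M.isL2_state hξ hw hx₀ hu hlj hj.le)
      ⟨(hu j hjl).1, (hu j hjl).2⟩ (hUbar j hjmem) (hU j hjmem)
    rw [← M.state_succ hlj] at h2
    rw [Finset.sum_eq_sum_Ico_succ_bot hj, Finset.sum_eq_sum_Ico_succ_bot hj]
    linarith

end Cost

end MFLQ.Problem

/-! ### The homogeneous problem. -/

namespace MFLQ.Problem

variable {Ω : Type*} {n m : ℕ} (M : Problem Ω n m)

section Homogeneous

/-- The Riccati equations involve only data that `homogeneous` leaves untouched, so testing the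
homogeneous problem bounds the weights of the original one. -/
theorem homogeneous_ricP (ε : ℝ) (k : ℕ) : M.homogeneous.ricP ε k = M.ricP ε k := rfl

theorem homogeneous_ricPi (ε : ℝ) (k : ℕ) : M.homogeneous.ricPi ε k = M.ricPi ε k := rfl

variable [m0 : MeasurableSpace Ω] {μ : Measure Ω}

theorem homogeneous_squareIntegrable : M.homogeneous.SquareIntegrable μ :=
  ⟨.zero', .zero', fun _ _ => ⟨.zero', .zero', .zero', .zero'⟩⟩

theorem homogeneous_deterministicWeights : M.homogeneous.DeterministicWeights μ :=
  ⟨⟨0, .rfl⟩, fun _ _ => ⟨⟨0, .rfl⟩, ⟨0, .rfl⟩⟩⟩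

theorem homogeneous_eta (ε : ℝ) {k : ℕ} (hk : k ≤ M.N) : M.homogeneous.eta μ ε k = 0 := by
  induction hk using Nat.decreasingInduction with
  | self =>
    rw [eta]
    refine (backward_terminal M.N _ _).trans ?_
    simp [homogeneous]
  | of_succ k hk ih =>
    rw [M.homogeneous.eta_eq μ ε hk, zeta, zetaOf, ih]
    simp [homogeneous]

theorem homogeneous_zeta (ε : ℝ) {k : ℕ} (hk : k < M.N) : M.homogeneous.zeta μ ε k = 0 := by
  rw [zeta, zetaOf, M.homogeneous_eta ε (Nat.succ_le_of_lt hk)]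
  simp [homogeneous]

theorem homogeneous_stageConst (ε : ℝ) (k : ℕ) : M.homogeneous.stageConst μ ε k = 0 := by
  rw [stageConst]; simp [homogeneous]

theorem homogeneous_step_zero (w : ℕ → Ω → ℝ) (k : ℕ) :
    M.homogeneous.step μ w k (fun _ => 0) (fun _ => 0) = fun _ => 0 := by
  funext ω; simp [step, homogeneous]

theorem homogeneous_runningCost_zero (ε : ℝ) (k : ℕ) :
    M.homogeneous.runningCost μ ε k (fun _ => 0) (fun _ => 0) = 0 := by
  simp [runningCost]

variable [IsProbabilityMeasure μ] {w : ℕ → Ω → ℝ} {l : ℕ} {ξ : Ω → Fin n → ℝ} {k : ℕ}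
  (hξ : Measurable ξ) (hw : IsNoise μ w l M.N ξ) (hk : k ∈ Finset.Ico l M.N)

include hξ hw hk

/-- The dynamic programming identity of the homogeneous problem at the zero state; no inverse is
involved. -/
theorem homogeneous_stageValue_step (ε : ℝ) {u : Ω → Fin m → ℝ}
    (hu : IsL2 μ (past w l ξ k) u) :
    M.homogeneous.stageValue μ ε (k + 1) (M.homogeneous.step μ w k (fun _ => 0) u)
        + M.homogeneous.runningCost μ ε k (fun _ => 0) u
      = ∫ ω, (M.upsilon ε k *ᵥ centered μ u ω) ⬝ᵥ centered μ u ω ∂μ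
        + (M.upsilonBar ε k *ᵥ ∫ ω, u ω ∂μ) ⬝ᵥ ∫ ω, u ω ∂μ := by
  have hx : IsL2 μ (past w l ξ k) fun _ => (0 : Fin n → ℝ) := .const 0
  have huc := hu.centered
  have hB := (huc.mulVec (M.B k)).memLp
  have hD := (huc.mulVec (M.D k)).memLp
  have hx0 : centered μ (fun _ : Ω => (0 : Fin n → ℝ)) = fun _ => 0 := by
    funext ω; simp [centered]
  have e1 : ∀ ω, (M.upsilon ε k *ᵥ centered μ u ω) ⬝ᵥ centered μ u ω
      = (M.ricP ε (k + 1) *ᵥ (M.B k *ᵥ centered μ u ω)) ⬝ᵥ (M.B k *ᵥ centered μ u ω)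
        + (M.ricP ε (k + 1) *ᵥ (M.D k *ᵥ centered μ u ω)) ⬝ᵥ (M.D k *ᵥ centered μ u ω)
        + ((M.R k + ε • 1) *ᵥ centered μ u ω) ⬝ᵥ centered μ u ω := fun ω => by
    simp only [upsilon, upsilonOf, Matrix.add_mulVec, add_dotProduct, Matrix.mul_assoc,
      ← Matrix.mulVec_mulVec, transpose_mulVec_dotProduct]
    ring
  have e2 : (M.upsilonBar ε k *ᵥ ∫ ω, u ω ∂μ) ⬝ᵥ (∫ ω, u ω ∂μ)
      = (M.ricPi ε (k + 1) *ᵥ ((M.B k + M.Bbar k) *ᵥ ∫ ω, u ω ∂μ)) ⬝ᵥ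
          ((M.B k + M.Bbar k) *ᵥ ∫ ω, u ω ∂μ)
        + (M.ricP ε (k + 1) *ᵥ ((M.D k + M.Dbar k) *ᵥ ∫ ω, u ω ∂μ)) ⬝ᵥ
          ((M.D k + M.Dbar k) *ᵥ ∫ ω, u ω ∂μ)
        + ((M.R k + M.Rbar k + ε • 1) *ᵥ ∫ ω, u ω ∂μ) ⬝ᵥ (∫ ω, u ω ∂μ) := by
    simp only [upsilonBar, upsilonBarOf]
    -- Made opaque so that `Matrix.add_mulVec` does not distribute these sums.
    generalize M.B k + M.Bbar k = B
    generalize M.D k + M.Dbar k = D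
    simp only [Matrix.add_mulVec, add_dotProduct, Matrix.mul_assoc,
      ← Matrix.mulVec_mulVec, transpose_mulVec_dotProduct]
    ring
  have hsum := (((HasMean.quad (M.ricP ε (k + 1)) hB hB).add
    (HasMean.quad (M.ricP ε (k + 1)) hD hD)).add
    (HasMean.quad (M.R k + ε • 1) huc.memLp huc.memLp)).2
  rw [stageValue, M.homogeneous.integral_quad_step hξ hw hk hx hu,
    M.homogeneous.integral_step hξ hw hk hx hu,
    M.homogeneous.runningCost_eq hx.memLp hu.memLp, hx0,
    M.homogeneous_eta ε (Nat.succ_le_of_lt (Finset.mem_Ico.1 hk).2)]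
  simp only [e1, e2, hsum, M.homogeneous_ricP, M.homogeneous_ricPi]
  simp [homogeneous]
  ring

end Homogeneous

end MFLQ.Problem

namespace MFLQ.Problem

variable {Ω : Type*} {n m : ℕ} (M : Problem Ω n m) [m0 : MeasurableSpace Ω] {μ : Measure Ω}
  {w : ℕ → Ω → ℝ} {l : ℕ} {ξ : Ω → Fin n → ℝ}

/-! ### Positivity of the weights from the convexity condition. -/

section Positivity

variable [IsProbabilityMeasure μ] (hξ : Measurable ξ) (hw : IsNoise μ w l M.N ξ)
  (hA1 : M.ConvexityCondition μ w l ξ)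

include hξ hw hA1

/-- Testing the convexity condition with a control that acts freely at time `k` only and follows the
feedback law of the homogeneous problem afterwards. -/
theorem regularized_quad_bound {ε : ℝ} (hε : 0 < ε) {k : ℕ} (hk : k ∈ Finset.Ico l M.N)
    (hnext : ∀ j ∈ Finset.Ico (k + 1) M.N,
      IsUnit (M.upsilonBar ε j).det ∧ IsUnit (M.upsilon ε j).det)
    {v : Ω → Fin m → ℝ} (hv : IsL2 μ (past w l ξ k) v) :
    ε * ∫ ω, v ω ⬝ᵥ v ω ∂μ
      ≤ ∫ ω, (M.upsilon ε k *ᵥ centered μ v ω) ⬝ᵥ centered μ v ω ∂μ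
        + (M.upsilonBar ε k *ᵥ ∫ ω, v ω ∂μ) ⬝ᵥ ∫ ω, v ω ∂μ := by
  obtain ⟨hlk, hkN⟩ := Finset.mem_Ico.1 hk
  set H := M.homogeneous with hH
  let policy : ℕ → (Ω → Fin n → ℝ) → (Ω → Fin m → ℝ) := fun j x =>
    if j < k then fun _ => 0 else if j = k then v else H.feedbackLaw μ ε j x
  have hpol : ∀ j ∈ Finset.Ico l M.N, ∀ x, IsL2 μ (past w l ξ j) x →
      IsL2 μ (past w l ξ j) (policy j x) := by
    intro j _ x hx
    simp only [policy]
    split_ifs with h1 h2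
    · exact .const 0
    · subst h2; exact hv
    · exact H.isL2_feedbackLaw ε j hx
  have h0 : IsL2 μ (past w l ξ l) fun _ => (0 : Fin n → ℝ) := .const 0
  set X := H.trajectory μ w l (fun _ => 0) policy with hX
  set u : ℕ → Ω → Fin m → ℝ := fun j => policy j (X j) with hu
  have hadm : u ∈ Admissible μ w l M.N ξ := H.admissible_policy hξ hw h0 hpol
  have hstate : H.state μ w l (fun _ => 0) u = X := H.state_policy
  have hXL : ∀ j ∈ Finset.Ico l M.N, IsL2 μ (past w l ξ j) (X j) := fun j hj =>
    H.isL2_trajectory hξ hw h0 hpol (Finset.mem_Ico.1 hj).1 (Finset.mem_Ico.1 hj).2.le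
  have hu0 : ∀ j < k, u j = fun _ => 0 := fun j hj => if_pos hj
  have huk : u k = v := by simp [hu, policy]
  have hX0 : ∀ j, j ≤ k → X j = fun _ => 0 := by
    intro j
    induction j with
    | zero => intro _; rfl
    | succ j ih =>
      intro hj
      rcases lt_or_ge j l with h | h
      · exact H.trajectory_of_le h
      · rw [hX, H.trajectory_succ h, ← hX]
        change H.step μ w j (X j) (u j) = _
        rw [ih (Nat.le_of_succ_le hj), hu0 j hj, hH, M.homogeneous_step_zero]
  have hcost : H.costReg μ w l (fun _ => 0) ε u
      = ∫ ω, (M.upsilon ε k *ᵥ centered μ v ω) ⬝ᵥ centered μ v ω ∂μ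
        + (M.upsilonBar ε k *ᵥ ∫ ω, v ω ∂μ) ⬝ᵥ ∫ ω, v ω ∂μ := by
    have hbefore : ∑ j ∈ Finset.Ico l k, H.runningCost μ ε j (X j) (u j) = 0 :=
      Finset.sum_eq_zero fun j hj => by
        have hj' := (Finset.mem_Ico.1 hj).2
        rw [hX0 j hj'.le, hu0 j hj', hH, M.homogeneous_runningCost_zero]
    -- Telescoping starts at `k + 1`, because `upsilon` and `upsilonBar` at `k` are not yet known to
    -- be invertible; time `k` is treated by `homogeneous_stageValue_step`.
    have hafter := H.stageValue_add_sum hξ hw h0 hadm (j := k + 1) (ε := ε)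
      (hlk.trans (Nat.le_succ k)) hkN (fun j hj => (hnext j hj).1) (fun j hj => .inl (hnext j hj).2)
    rw [hstate] at hafter
    have hzero : ∑ j ∈ Finset.Ico (k + 1) H.N, (H.gap μ ε j (X j) (u j)
        + (H.stageConst μ ε j + H.zeta μ ε j ⬝ᵥ H.vOffset μ ε j)) = 0 :=
      Finset.sum_eq_zero fun j hj => by
        obtain ⟨hj1, hj2⟩ := Finset.mem_Ico.1 hj
        have huj : u j = H.feedbackLaw μ ε j (X j) := by
          simp only [hu, policy]
          rw [if_neg (by omega), if_neg (by omega)]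
        rw [huj, H.gap_feedbackLaw ε j
          (hXL j (Finset.mem_Ico.2 ⟨by omega, hj2⟩)).memLp, hH, M.homogeneous_stageConst,
          M.homogeneous_zeta ε hj2]
        simp
    have hstep := M.homogeneous_stageValue_step hξ hw hk ε hv
    have hXk : X (k + 1) = H.step μ w k (fun _ => 0) v := by
      rw [hX, H.trajectory_succ hlk, ← hX]
      change H.step μ w k (X k) (u k) = _
      rw [hX0 k le_rfl, huk]
    rw [H.costReg_eq hξ hw h0 hadm M.homogeneous_squareIntegrable
      M.homogeneous_deterministicWeights (hlk.trans hkN.le), hstate,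
      ← Finset.sum_Ico_consecutive _ hlk (show k ≤ H.N from hkN.le), hbefore,
      Finset.sum_eq_sum_Ico_succ_bot (show k < H.N from hkN), hX0 k le_rfl, huk]
    rw [hzero, hXk] at hafter
    linarith
  -- The unregularized homogeneous cost is nonnegative, and among the penalty terms the one at time
  -- `k` is already $\varepsilon\mathbb E|v|^2$.
  rw [← hcost, costReg, (H.hasMean_control_sq hadm).2]
  have hnn := hA1 u hadm
  have hle : ∫ ω, v ω ⬝ᵥ v ω ∂μ ≤ ∑ j ∈ Finset.Ico l M.N, ∫ ω, u j ω ⬝ᵥ u j ω ∂μ := by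
    rw [← huk]
    exact Finset.single_le_sum (f := fun j => ∫ ω, u j ω ⬝ᵥ u j ω ∂μ)
      (fun j _ => integral_nonneg fun ω => Finset.sum_nonneg fun i _ => mul_self_nonneg _) hk
  have := mul_le_mul_of_nonneg_left hle hε.le
  exact this.trans (le_add_of_nonneg_left hnn)

/-- Testing with the controls `s • v`, where `s` is a centered scalar, bounds `upsilon` below. -/
theorem upsilon_sub_posSemidef_of_test {ε : ℝ} (hε : 0 < ε) {k : ℕ} (hk : k ∈ Finset.Ico l M.N)
    (hnext : ∀ j ∈ Finset.Ico (k + 1) M.N,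
      IsUnit (M.upsilonBar ε j).det ∧ IsUnit (M.upsilon ε j).det)
    {s : Ω → ℝ} (hs : Measurable[past w l ξ k] s) (hs2 : MemLp s 2 μ) (hs0 : ∫ ω, s ω ∂μ = 0)
    (hpos : 0 < ∫ ω, s ω ^ 2 ∂μ) : (M.upsilon ε k - ε • 1).PosSemidef := by
  refine posSemidef_of_quad_nonneg
    ((M.upsilon_symm ε (Finset.mem_Ico.1 hk).2).sub (smul_one_symm ε)) fun v => ?_
  have hv : IsL2 μ (past w l ξ k) fun ω => s ω • v := .smul_const hs hs2 v
  have hmean : ∫ ω, s ω • v ∂μ = 0 := by rw [integral_smul_const, hs0, zero_smul]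
  have hc : ∀ ω, centered μ (fun ω => s ω • v) ω = s ω • v := fun ω => by
    rw [centered, hmean, sub_zero]
  have h := M.regularized_quad_bound hξ hw hA1 hε hk hnext hv
  have e1 : ∀ ω, (s ω • v) ⬝ᵥ (s ω • v) = s ω ^ 2 * (v ⬝ᵥ v) := fun ω => by
    simp only [smul_dotProduct, dotProduct_smul, smul_eq_mul]; ring
  have e2 : ∀ ω, (M.upsilon ε k *ᵥ (s ω • v)) ⬝ᵥ (s ω • v)
      = s ω ^ 2 * ((M.upsilon ε k *ᵥ v) ⬝ᵥ v) := fun ω => by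
    simp only [Matrix.mulVec_smul, smul_dotProduct, dotProduct_smul, smul_eq_mul]; ring
  simp only [hc, hmean, e1, e2, integral_mul_const, Matrix.mulVec_zero, zero_dotProduct,
    add_zero] at h
  rw [Matrix.sub_mulVec, sub_dotProduct, Matrix.smul_mulVec, Matrix.one_mulVec, smul_dotProduct,
    smul_eq_mul, sub_nonneg]
  exact le_of_mul_le_mul_left (by linarith) hpos

/-- Deterministic controls are always admissible and have no deviation, so they isolate
`upsilonBar`, with no exceptional case. -/
theorem upsilonBar_sub_posSemidef_of_next {ε : ℝ} (hε : 0 < ε) {k : ℕ}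
    (hk : k ∈ Finset.Ico l M.N)
    (hnext : ∀ j ∈ Finset.Ico (k + 1) M.N,
      IsUnit (M.upsilonBar ε j).det ∧ IsUnit (M.upsilon ε j).det) :
    (M.upsilonBar ε k - ε • 1).PosSemidef := by
  refine posSemidef_of_quad_nonneg
    ((M.upsilonBar_symm ε (Finset.mem_Ico.1 hk).2).sub (smul_one_symm ε)) fun v => ?_
  have h := M.regularized_quad_bound hξ hw hA1 hε hk hnext (.const v)
  have hc : ∀ ω, centered μ (fun _ : Ω => v) ω = 0 := fun ω => by simp [centered]
  simp only [hc, integral_const, probReal_univ, one_smul, smul_eq_mul, one_mul,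
    Matrix.mulVec_zero, zero_dotProduct, mul_zero, zero_add] at h
  rw [Matrix.sub_mulVec, sub_dotProduct, Matrix.smul_mulVec, Matrix.one_mulVec, smul_dotProduct,
    smul_eq_mul, sub_nonneg]
  exact h

/-- A centered scalar of positive variance is needed in the past: the last noise `w (k - 1)` if `l <
k`, otherwise a component of $\xi-\mathbb E\xi$, which cannot all vanish unless $\xi$ is a.s.
constant. -/
theorem upsilon_sub_posSemidef_of_next (hξ2 : MemLp ξ 2 μ) {ε : ℝ} (hε : 0 < ε) {k : ℕ}
    (hk : k ∈ Finset.Ico l M.N)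
    (hnext : ∀ j ∈ Finset.Ico (k + 1) M.N,
      IsUnit (M.upsilonBar ε j).det ∧ IsUnit (M.upsilon ε j).det)
    (h : l < k ∨ ¬ ∃ c, ξ =ᵐ[μ] fun _ => c) : (M.upsilon ε k - ε • 1).PosSemidef := by
  obtain ⟨hlk, hkN⟩ := Finset.mem_Ico.1 hk
  rcases h with h | h
  · obtain ⟨j, rfl⟩ : ∃ j, k = j + 1 := ⟨k - 1, by omega⟩
    obtain ⟨-, hw0, hw1, hw2⟩ := hw j (Finset.mem_Ico.2 ⟨by omega, by omega⟩)
    have hle := past_le hξ hw (show j ≤ M.N by omega)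
    exact M.upsilon_sub_posSemidef_of_test hξ hw hA1 hε hk hnext
      (measurable_past_noise (Finset.mem_Ico.2 ⟨by omega, by omega⟩)) hw0
      (integral_noise hle hw1) (by rw [integral_noise_sq hle hw2]; exact one_pos)
  · have hc : IsL2 μ (past w l ξ k) (centered μ ξ) :=
      IsL2.centered ⟨measurable_past_init k, hξ2⟩
    obtain ⟨i, hi⟩ : ∃ i, ∫ ω, centered μ ξ ω i ^ 2 ∂μ ≠ 0 := by
      by_contra! hall
      refine h ⟨∫ ω, ξ ω ∂μ, ?_⟩
      have hae : ∀ i, ∀ᵐ ω ∂μ, centered μ ξ ω i ^ 2 = 0 := fun i =>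
        (integral_eq_zero_iff_of_nonneg (fun ω => sq_nonneg _)
          (hc.memLp.eval i).integrable_sq).1 (hall i)
      filter_upwards [ae_all_iff.2 hae] with ω hω
      ext i
      have := pow_eq_zero_iff (two_ne_zero) |>.1 (hω i)
      simpa [centered, sub_eq_zero] using this
    refine M.upsilon_sub_posSemidef_of_test hξ hw hA1 hε hk hnext (hc.eval_meas i)
      (hc.memLp.eval i) ?_ (lt_of_le_of_ne (integral_nonneg fun ω => sq_nonneg _) hi.symm)
    rw [← eval_integral fun i => (hc.memLp.eval i).integrable (by norm_num),
      integral_centered hξ2, Pi.zero_apply]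

/-- Uniform positivity of the weights of the regularized problem. -/
theorem sub_posSemidef (hξ2 : MemLp ξ 2 μ) {ε : ℝ} (hε : 0 < ε) {k : ℕ} (hlk : l ≤ k)
    (hk : k ≤ M.N) : ∀ j ∈ Finset.Ico k M.N, (M.upsilonBar ε j - ε • 1).PosSemidef ∧
      ((l < j ∨ ¬ ∃ c, ξ =ᵐ[μ] fun _ => c) → (M.upsilon ε j - ε • 1).PosSemidef) := by
  induction hk using Nat.decreasingInduction with
  | self => simp
  | of_succ k hk ih =>
    have ih := ih (hlk.trans (Nat.le_succ k))
    -- Here `j > k ≥ l`, so the exceptional case never obstructs the induction.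
    have hnext : ∀ j ∈ Finset.Ico (k + 1) M.N,
        IsUnit (M.upsilonBar ε j).det ∧ IsUnit (M.upsilon ε j).det := fun j hj =>
      have h := ih j hj
      ⟨(posDef_of_sub_smul_one hε h.1).det_pos.ne'.isUnit,
        (posDef_of_sub_smul_one hε (h.2 (.inl (by
          have := (Finset.mem_Ico.1 hj).1; omega)))).det_pos.ne'.isUnit⟩
    intro j hj
    rcases (Finset.mem_Ico.1 hj).1.eq_or_lt with rfl | h
    · have hk' : k ∈ Finset.Ico l M.N := Finset.mem_Ico.2 ⟨hlk, hk⟩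
      exact ⟨M.upsilonBar_sub_posSemidef_of_next hξ hw hA1 hε hk' hnext,
        M.upsilon_sub_posSemidef_of_next hξ hw hA1 hξ2 hε hk' hnext⟩
    · exact ih j (Finset.mem_Ico.2 ⟨h, (Finset.mem_Ico.1 hj).2⟩)

end Positivity

/-! ### Optimality of the feedback control. -/

section Optimality

variable [IsProbabilityMeasure μ]

/-- No noise has been observed at time `l`, so `f` factors through `ξ` and inherits its constancy.
-/
theorem centered_ae_zero_of_const {a : ℕ} {c : Fin n → ℝ} (hc : ξ =ᵐ[μ] fun _ => c)
    {f : Ω → Fin a → ℝ} (hf : Measurable[past w l ξ l] f) : centered μ f =ᵐ[μ] 0 := by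
  have hpast : past w l ξ l = MeasurableSpace.comap ξ inferInstance := by simp [past]
  rw [hpast] at hf
  obtain ⟨φ, -, rfl⟩ := hf.exists_eq_measurable_comp
  have h : φ ∘ ξ =ᵐ[μ] fun _ => φ c := hc.mono fun ω h => congrArg φ h
  have hmean : ∫ ω, (φ ∘ ξ) ω ∂μ = φ c := by rw [integral_congr_ae h]; simp
  filter_upwards [h] with ω hω
  rw [centered, hmean, hω, sub_self, Pi.zero_apply]

/-- By telescoping, the regularized costs of two controls differ only through their gaps, which are
zero for the feedback and nonnegative for every competitor. -/
theorem feedbackControl_isOptimalReg (hM : M.SquareIntegrable μ) (hdet : M.DeterministicWeights μ)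
    (hl : l ≤ M.N) (hξ : Measurable ξ) (hξ2 : MemLp ξ 2 μ) (hw : IsNoise μ w l M.N ξ)
    (hA1 : M.ConvexityCondition μ w l ξ) {ε : ℝ} (hε : 0 < ε) :
    M.IsOptimalReg μ w l ξ ε (M.feedbackControl μ w l ξ ε) := by
  have hpd := M.sub_posSemidef hξ hw hA1 hξ2 hε le_rfl hl
  have h0 : IsL2 μ (past w l ξ l) ξ := ⟨measurable_past_init l, hξ2⟩
  have hpol : ∀ k ∈ Finset.Ico l M.N, ∀ x, IsL2 μ (past w l ξ k) x →
      IsL2 μ (past w l ξ k) (M.feedbackLaw μ ε k x) := fun k _ x hx => M.isL2_feedbackLaw ε k hx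
  have hadm : M.feedbackControl μ w l ξ ε ∈ Admissible μ w l M.N ξ :=
    M.admissible_policy hξ hw h0 hpol
  have hbar : ∀ k ∈ Finset.Ico l M.N, (M.upsilonBar ε k).PosDef := fun k hk =>
    posDef_of_sub_smul_one hε (hpd k hk).1
  -- Either `upsilon` is positive definite, or `k = l` with `ξ` a.s. constant, and then all
  -- deviations at that time vanish.
  have hdich : ∀ u ∈ Admissible (m := m) μ w l M.N ξ, ∀ k ∈ Finset.Ico l M.N,
      (M.upsilon ε k).PosDef ∨
        centered μ (M.state μ w l ξ u k) =ᵐ[μ] 0 ∧ centered μ (u k) =ᵐ[μ] 0 := by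
    intro u hu k hk
    by_cases h : l < k ∨ ¬ ∃ c, ξ =ᵐ[μ] fun _ => c
    · exact .inl (posDef_of_sub_smul_one hε ((hpd k hk).2 h))
    · push Not at h
      obtain ⟨hkl, c, hc⟩ := h
      obtain rfl : k = l := le_antisymm hkl (Finset.mem_Ico.1 hk).1
      exact .inr ⟨centered_ae_zero_of_const hc
        (M.isL2_state hξ hw h0 hu le_rfl (Finset.mem_Ico.1 hk).2.le).meas,
        centered_ae_zero_of_const hc (hu k hk).1⟩
  have hcost : ∀ u ∈ Admissible (m := m) μ w l M.N ξ, M.costReg μ w l ξ ε u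
      = M.stageValue μ ε l ξ + ∑ k ∈ Finset.Ico l M.N,
        (M.gap μ ε k (M.state μ w l ξ u k) (u k)
          + (M.stageConst μ ε k + M.zeta μ ε k ⬝ᵥ M.vOffset μ ε k)) := fun u hu => by
    rw [M.costReg_eq hξ hw h0 hu hM hdet hl, M.stageValue_add_sum hξ hw h0 hu le_rfl hl
      (fun k hk => (hbar k hk).det_pos.ne'.isUnit)
      (fun k hk => (hdich u hu k hk).imp_left fun h => h.det_pos.ne'.isUnit)]
    rw [state, M.trajectory_of_le le_rfl]
  refine ⟨hadm, fun v hv => ?_⟩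
  rw [hcost _ hadm, hcost v hv]
  gcongr with k hk
  have hstate : M.state μ w l ξ (M.feedbackControl μ w l ξ ε)
      = M.trajectory μ w l ξ (M.feedbackLaw μ ε) := M.state_policy
  have hzero : M.gap μ ε k (M.state μ w l ξ (M.feedbackControl μ w l ξ ε) k)
      (M.feedbackControl μ w l ξ ε k) = 0 := by
    have hkm := Finset.mem_Ico.1 hk
    rw [hstate]
    exact M.gap_feedbackLaw ε k (M.isL2_trajectory hξ hw h0 hpol hkm.1 hkm.2.le).memLp
  rw [hzero]
  exact M.gap_nonneg (hbar k hk).posSemidef ((hdich v hv k hk).imp_left fun h => h.posSemidef)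

end Optimality

/-! ### The limit as $\varepsilon\downarrow0$. -/

section Limit

theorem cost_le_costReg {ε : ℝ} (hε : 0 ≤ ε) (u : ℕ → Ω → Fin m → ℝ) :
    M.cost μ w l ξ u ≤ M.costReg μ w l ξ ε u :=
  le_add_of_nonneg_right (mul_nonneg hε (integral_nonneg fun _ =>
    Finset.sum_nonneg fun _ _ => Finset.sum_nonneg fun _ _ => mul_self_nonneg _))

theorem value_le_valueReg {ε : ℝ} (hε : 0 ≤ ε) : M.value μ w l ξ ≤ M.valueReg μ w l ξ ε :=
  iInf₂_mono fun u _ => EReal.coe_le_coe_iff.2 (M.cost_le_costReg hε u)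

/-- An infimum of functions continuous in $\varepsilon$ is upper semicontinuous, and $V$ is a lower
bound. The order formulation in `EReal` covers $V=-\infty$ without a separate case. -/
theorem tendsto_valueReg :
    Tendsto (fun ε : ℝ => M.valueReg μ w l ξ ε) (𝓝[>] 0) (𝓝 (M.value μ w l ξ)) := by
  refine tendsto_order.2 ⟨fun a ha => ?_, fun a ha => ?_⟩
  · filter_upwards [self_mem_nhdsWithin] with ε hε
    exact ha.trans_le (M.value_le_valueReg (le_of_lt hε))
  · obtain ⟨u, hu, hua⟩ : ∃ u, ∃ _ : u ∈ Admissible (m := m) μ w l M.N ξ,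
        ((M.cost μ w l ξ u : ℝ) : EReal) < a := by
      simpa only [value, iInf_lt_iff] using ha
    have hlim : Tendsto (fun ε : ℝ => ((M.costReg μ w l ξ ε u : ℝ) : EReal)) (𝓝[>] 0)
        (𝓝 ((M.cost μ w l ξ u : ℝ) : EReal)) := by
      refine (continuous_coe_real_ereal.tendsto _).comp (tendsto_nhdsWithin_of_tendsto_nhds ?_)
      have hcont : Continuous fun ε : ℝ => M.costReg μ w l ξ ε u := by
        simp only [costReg]; fun_prop
      simpa [costReg] using hcont.tendsto 0
    filter_upwards [hlim.eventually (gt_mem_nhds hua)] with ε hε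
    exact (iInf₂_le u hu).trans_lt hε

theorem isFiniteAt_iff : M.IsFiniteAt μ w l ξ ↔
    ∃ c : ℝ, ∀ ε : ℝ, 0 < ε → (c : EReal) ≤ M.valueReg μ w l ξ ε := by
  constructor
  · intro h
    obtain ⟨c, -, hc⟩ := EReal.lt_iff_exists_real_btwn.1 h
    exact ⟨c, fun ε hε => hc.le.trans (M.value_le_valueReg hε.le)⟩
  · rintro ⟨c, hc⟩
    refine (EReal.bot_lt_coe c).trans_le (ge_of_tendsto M.tendsto_valueReg ?_)
    filter_upwards [self_mem_nhdsWithin] with ε hε using hc ε hε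

/-- The unregularized costs are squeezed between $V$ and $V^\varepsilon$. -/
theorem isMinimizing_of_isOptimalReg {u : ℝ → ℕ → Ω → Fin m → ℝ}
    (hu : ∀ ε : ℝ, 0 < ε → M.IsOptimalReg μ w l ξ ε (u ε)) : M.IsMinimizing μ w l ξ u := by
  refine ⟨fun ε hε => (hu ε hε).1, tendsto_of_tendsto_of_tendsto_of_le_of_le' tendsto_const_nhds
    M.tendsto_valueReg ?_ ?_⟩
  · filter_upwards [self_mem_nhdsWithin] with ε hε using iInf₂_le (u ε) (hu ε hε).1
  · filter_upwards [self_mem_nhdsWithin] with ε hε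
    exact le_iInf₂ fun v hv => EReal.coe_le_coe_iff.2
      ((M.cost_le_costReg (le_of_lt hε) (u ε)).trans ((hu ε hε).2 v hv))

end Limit

end MFLQ.Problem

theorem theorem6p2 {Ω : Type*} [MeasurableSpace Ω] (μ : MeasureTheory.Measure Ω)
    [MeasureTheory.IsProbabilityMeasure μ] {n m : ℕ} (M : MFLQ.Problem Ω n m)
    (hM : M.SquareIntegrable μ) (l : ℕ) (hl : l < M.N)
    (ξ : Ω → Fin n → ℝ) (hξ : Measurable ξ) (hξ2 : MeasureTheory.MemLp ξ 2 μ)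
    (w : ℕ → Ω → ℝ) (hw : MFLQ.IsNoise μ w l M.N ξ)
    (hA1 : M.ConvexityCondition μ w l ξ) :
    -- (i) convergence of the value functions, and the characterization of finiteness
    (Tendsto (fun ε : ℝ => M.valueReg μ w l ξ ε) (𝓝[>] 0) (𝓝 (M.value μ w l ξ)) ∧
      (M.IsFiniteAt μ w l ξ ↔ ∃ c : ℝ, ∀ ε : ℝ, 0 < ε → (c : EReal) ≤ M.valueReg μ w l ξ ε)) ∧
    -- (ii) the inverses in the Riccati equations are genuine
    (∀ ε : ℝ, 0 < ε → ∀ k ∈ Finset.Ico l M.N,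
      (M.upsilonBar ε k - ε • 1).PosSemidef ∧
      ((l < k ∨ ¬ ∃ c, ξ =ᵐ[μ] fun _ => c) → (M.upsilon ε k - ε • 1).PosSemidef)) ∧
    -- the feedback controls are optimal for the regularized problems, and minimizing
    (M.DeterministicWeights μ →
      (∀ ε : ℝ, 0 < ε → M.IsOptimalReg μ w l ξ ε (M.feedbackControl μ w l ξ ε)) ∧
      M.IsMinimizing μ w l ξ (M.feedbackControl μ w l ξ)) ∧
    -- for random weights, optimal controls of the regularized problems are minimizing
    (∀ u : ℝ → ℕ → Ω → Fin m → ℝ, (∀ ε : ℝ, 0 < ε → M.IsOptimalReg μ w l ξ ε (u ε)) →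
      M.IsMinimizing μ w l ξ u) :=
  ⟨⟨M.tendsto_valueReg, M.isFiniteAt_iff⟩,
    fun _ hε => M.sub_posSemidef hξ hw hA1 hξ2 hε le_rfl hl.le,
    fun hdet =>
      have hopt := fun ε hε =>
        M.feedbackControl_isOptimalReg hM hdet hl.le hξ hξ2 hw hA1 (ε := ε) hε
      ⟨hopt, M.isMinimizing_of_isOptimalReg hopt⟩,
    fun _ hu => M.isMinimizing_of_isOptimalReg hu⟩
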